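/- **Relative $R$-polynomials.** Let $(W,S)$ be a Coxeter system with length function $\ell$ and (strong) Bruhat order $\le$, let $J\subseteq S$, and let $W^J=\{w\in W:\ell(ws)>\ell(w)\text{ for all }s\in J\}$ be the set of minimal length representatives of the cosets $wW_J$. Let $D_L(w)=\{s\in S:\ell(sw)<\ell(w)\}$. The relative $R$-polynomials $R^J_{u,v}(q)\in\mathbb Z[q]$ ($u,v\in W^J$; Deodhar's type $x=-1$) are the unique family with $R^J_{u,v}=0$ if $u\not\le v$, $R^J_{u,u}=1$, and, for $u<v$ and $s\in D_L(v)$, $$R^J_{u,v}=\begin{cases}R^J_{su,sv}&\text{if }su<u,\\ q\,R^J_{u,sv}&\text{if }u<su\notin W^J,\\ (q-1)R^J_{u,sv}+q\,R^J_{su,sv}&\text{if }u<su\in W^J.\end{cases}$$ **Diagrams of Hermitian type.** Number the simple reflections $s_1,\dots,s_n$ as in Bourbaki and abbreviate $s_i$ by $i$. For each of the following pairs $W/W_J$, where $J=S\setminus\{s_m\}$, the diagram of Hermitian type is the given set of labelled boxes $(r,c)$ (row $r$ from the top, column $c$ from the left, counted from $1$). * $A_n/(A_{p-1}\times A_{n-p})$,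 $1\le p\le n$, $m=p$: boxes $1\le r\le n-p+1$, $1\le c\le p$, with label $p+r-c$. * $B_n/B_{n-1}$, $n\ge2$, $m=1$: row $1$ is $1,2,\dots,n$ in columns $1,\dots,n$; for $2\le r\le n$, row $r$ is the single box $(r,n)$ with label $n-r+1$. * $C_n/A_{n-1}$, $n\ge2$, $m=n$: boxes $1\le r\le c\le n$, with label $n-(c-r)$. * $D_n/A_{n-1}$, $n\ge3$, $m=n$: boxes $1\le r\le c\le n-1$; the label is $n-1-(c-r)$ if $r<c$, it is $n$ if $r=c$ is odd, and $n-1$ if $r=c$ is even. * $D_n/D_{n-1}$, $n\ge3$, $m=1$: row $1$ is $1,2,\dots,n-2,n$ in columns $1,\dots,n-1$; row $2$ is $n-1,\,n-2$ in columns $n-2,\,n-1$; for $3\le r\le n-1$, row $r$ is the single box $(r,n-1)$ with label $n-r$. * $E_6/D_5$, $m=1$: the rows are $1,3,4,5,6$ (starting in column $1$); $2,4,5$ (column $3$); $3,4,2$ (column $4$); $1,3,4,5,6$ (column $4$). * $E_7/E_6$, $m=7$: the rows are $7,6,5,4,3,1$ (starting in column $1$); $2,4,3$ (column $4$); $5,4,2$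 (column $5$); $6,5,4,3,1$ (column $5$); $7,6,5,4,3$ (column $5$); $2,4$ (column $8$); $5$ (column $9$); $6$ (column $9$); $7$ (column $9$). A *subdiagram* is a set of boxes that contains, with any box, all boxes of the diagram lying weakly above and weakly to the left of it. A subdiagram with rows $1,\dots,t$ is the diagram of the element $w=r_t^{-1}\cdots r_2^{-1}r_1^{-1}\in W^J$, where $r_i$ is the product of the simple reflections labelling its $i$-th row, read from left to right. **Proposition.** Let $W/W_J$ be one of the pairs above and let $u,v\in W^J$ have diagrams $M$ and $\Lambda$, respectively, with $M\subseteq\Lambda$. If the skew diagram $\Lambda\setminus M$ consists of $k\ge1$ boxes that all lie in a single row, or all lie in a single column, then $$R^J_{u,v}(q)=(q-1)\,q^{k-1}.$$ -/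

import Mathlib

open Polynomial

/-! ### Coxeter groups: minimal coset representatives, Bruhat order, relative `R`-polynomials -/

section Deodhar

variable {B W : Type*} [Group W] {C : CoxeterMatrix B} (cs : CoxeterSystem C W)

/-- `W^J`: the minimal length representatives of the cosets `w W_J`. -/
def minCosetReps (J : Set B) : Set W :=
  {w | ∀ j ∈ J, cs.length w < cs.length (w * cs.simple j)}

/-- The strong Bruhat order: the reflexive transitive closure of `u ⟶ t u`
with `t` a reflection and `ℓ(u) < ℓ(t u)`. -/
def BruhatLE : W → W → Prop :=
  Relation.ReflTransGen fun u v =>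
    cs.length u < cs.length v ∧ ∃ t, cs.IsReflection t ∧ v = t * u

/-- Deodhar's characterization of the relative (parabolic) `R`-polynomials of `W^J` of type `x`,
as a family `R u v` of polynomials in `q = X`. Only the values at `u, v ∈ W^J` matter. -/
structure IsRelativeRFamily (J : Set B) (x : ℤ[X]) (R : W → W → ℤ[X]) : Prop where
  eq_zero : ∀ u ∈ minCosetReps cs J, ∀ v ∈ minCosetReps cs J, ¬ BruhatLE cs u v → R u v = 0
  self : ∀ u ∈ minCosetReps cs J, R u u = 1
  descent : ∀ u ∈ minCosetReps cs J, ∀ v ∈ minCosetReps cs J, BruhatLE cs u v → u ≠ v →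
    ∀ i, cs.IsLeftDescent v i → cs.IsLeftDescent u i →
      R u v = R (cs.simple i * u) (cs.simple i * v)
  ascent_notMem : ∀ u ∈ minCosetReps cs J, ∀ v ∈ minCosetReps cs J, BruhatLE cs u v → u ≠ v →
    ∀ i, cs.IsLeftDescent v i → ¬ cs.IsLeftDescent u i →
      cs.simple i * u ∉ minCosetReps cs J →
      R u v = (X - 1 - x) * R u (cs.simple i * v)
  ascent_mem : ∀ u ∈ minCosetReps cs J, ∀ v ∈ minCosetReps cs J, BruhatLE cs u v → u ≠ v →
    ∀ i, cs.IsLeftDescent v i → ¬ cs.IsLeftDescent u i →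
      cs.simple i * u ∈ minCosetReps cs J →
      R u v = (X - 1) * R u (cs.simple i * v) + X * R (cs.simple i * u) (cs.simple i * v)

open Classical in
/-- The relative `R`-polynomial `R^{J,x}_{u,v}` (for `u, v ∈ W^J`), computed by Deodhar's
recursion along left descents of `v`. By Deodhar's theorem the result does not depend on the
descents used; see `IsRelativeRFamily.eq_relativeR`. -/
noncomputable def relativeR (J : Set B) (x : ℤ[X]) (u v : W) : ℤ[X] :=
  if u = v then 1
  else if h : BruhatLE cs u v ∧ v ≠ 1 then
    let i := (cs.exists_leftDescent_of_ne_one h.2).choose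
    if cs.IsLeftDescent u i then
      relativeR J x (cs.simple i * u) (cs.simple i * v)
    else if cs.simple i * u ∈ minCosetReps cs J then
      (X - 1) * relativeR J x u (cs.simple i * v)
        + X * relativeR J x (cs.simple i * u) (cs.simple i * v)
    else
      (X - 1 - x) * relativeR J x u (cs.simple i * v)
  else 0
termination_by cs.length v
decreasing_by
  all_goals exact (cs.exists_leftDescent_of_ne_one h.2).choose_spec

theorem simple_mul_mem_minCosetReps {J : Set B} {u : W} (hu : u ∈ minCosetReps cs J) {i : B}
    (hi : cs.IsLeftDescent u i) : cs.simple i * u ∈ minCosetReps cs J := by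
  intro j hj
  have h1 := hu j hj
  have h2 := cs.isLeftDescent_iff.1 hi
  have h3 := cs.length_simple_mul (u * cs.simple j) i
  have h4 := cs.length_mul_simple_ne (cs.simple i * u) j
  rw [← mul_assoc] at h3
  omega

theorem BruhatLE.length_le {u v : W} (h : BruhatLE cs u v) : cs.length u ≤ cs.length v := by
  induction h with
  | refl => exact le_rfl
  | tail _ h ih => exact ih.trans h.1.le

/-- Any family with Deodhar's properties coincides with `relativeR` on `W^J`. -/
theorem IsRelativeRFamily.eq_relativeR {J : Set B} {x : ℤ[X]} {R : W → W → ℤ[X]}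
    (hR : IsRelativeRFamily cs J x R) {u v : W} (hu : u ∈ minCosetReps cs J)
    (hv : v ∈ minCosetReps cs J) : R u v = relativeR cs J x u v := by
  induction hn : cs.length v using Nat.strong_induction_on generalizing u v with
  | _ n ih =>
    subst hn
    rw [relativeR]
    split_ifs with h1 h2
    · subst h1
      exact hR.self u hu
    · have hi := (cs.exists_leftDescent_of_ne_one h2.2).choose_spec
      have hsv := simple_mul_mem_minCosetReps cs hv hi
      dsimp only
      split_ifs with h3 h4
      · rw [hR.descent u hu v hv h2.1 h1 _ hi h3]
        exact ih _ hi (simple_mul_mem_minCosetReps cs hu h3) hsv rfl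
      · rw [hR.ascent_mem u hu v hv h2.1 h1 _ hi h3 h4, ih _ hi hu hsv rfl, ih _ hi h4 hsv rfl]
      · rw [hR.ascent_notMem u hu v hv h2.1 h1 _ hi h3 h4, ih _ hi hu hsv rfl]
    · refine hR.eq_zero u hu v hv fun h => h2 ⟨h, ?_⟩
      rintro rfl
      have := BruhatLE.length_le cs h
      exact h1 (cs.length_eq_zero_iff.1 (by simpa using this))

end Deodhar

/-! ### Hermitian symmetric pairs and their diagrams -/

/-- The Hermitian symmetric pairs `W / W_J` (generators in Bourbaki's numbering):
`A n p` is `A_n / (A_{p-1} × A_{n-p})`, `B n` is `B_n / B_{n-1}`, `C n` is `C_n / A_{n-1}`,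
`DA n` is `D_n / A_{n-1}`, `DD n` is `D_n / D_{n-1}`, `E6` is `E_6 / D_5`, `E7` is `E_7 / E_6`. -/
inductive HermitianType
  | A (n p : ℕ) (hp : 1 ≤ p) (hpn : p ≤ n)
  | B (n : ℕ) (hn : 2 ≤ n)
  | C (n : ℕ) (hn : 2 ≤ n)
  | DA (n : ℕ) (hn : 3 ≤ n)
  | DD (n : ℕ) (hn : 3 ≤ n)
  | E6
  | E7

namespace HermitianType

/-- The Coxeter matrix of type `D_n`: a path on the first `n - 1` nodes, the last node being joined
to the third last one only. (Mathlib's `CoxeterMatrix.D` also joins the last two nodes.) -/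
def coxeterD (n : ℕ) : CoxeterMatrix (Fin n) where
  M := Matrix.of fun i j : Fin n =>
    if i = j then 1
    else if ((i : ℕ) + 1 = j ∧ (j : ℕ) + 1 < n) ∨ ((j : ℕ) + 1 = i ∧ (i : ℕ) + 1 < n) ∨
        ((i : ℕ) + 2 = j ∧ (j : ℕ) + 1 = n) ∨ ((j : ℕ) + 2 = i ∧ (i : ℕ) + 1 = n) then 3
    else 2
  isSymm := by
    ext i j
    simp only [Matrix.transpose_apply, Matrix.of_apply]
    split_ifs <;> first | rfl | (exfalso; simp only [Fin.ext_iff] at *; omega)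
  diagonal := by simp
  off_diagonal := by
    intro i j h
    simp only [Matrix.of_apply, if_neg h]
    split_ifs <;> decide

/-- The number of simple reflections of `W`. -/
def rank : HermitianType → ℕ
  | A n _ _ _ => n
  | B n _ => n
  | C n _ => n
  | DA n _ => n
  | DD n _ => n
  | E6 => 6
  | E7 => 7

theorem rank_pos (T : HermitianType) : 0 < T.rank := by
  cases T <;> simp only [rank] <;> omega

/-- The Coxeter matrix of `W`. -/
def coxeterMatrix : (T : HermitianType) → CoxeterMatrix (Fin T.rank)
  | A n _ _ _ => CoxeterMatrix.A n
  | B n _ => CoxeterMatrix.B n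
  | C n _ => CoxeterMatrix.B n
  | DA n _ => coxeterD n
  | DD n _ => coxeterD n
  | E6 => CoxeterMatrix.E₆
  | E7 => CoxeterMatrix.E₇

/-- The index in `Fin T.rank` of the simple reflection `s_i`, for a label `1 ≤ i ≤ T.rank`. -/
def index (T : HermitianType) (i : ℕ) : Fin T.rank :=
  ⟨(i - 1) % T.rank, Nat.mod_lt _ T.rank_pos⟩

/-- The label of the only simple reflection that does not belong to `J`. -/
def node : HermitianType → ℕ
  | A _ p _ _ => p
  | B _ _ => 1
  | C n _ => n
  | DA n _ => n
  | DD _ _ => 1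
  | E6 => 1
  | E7 => 7

/-- The set `J` of simple reflections that generates the parabolic subgroup `W_J`. -/
def J (T : HermitianType) : Set (Fin T.rank) := {i | i ≠ T.index T.node}

/-- The label of the box in row `r` and column `c` (both counted from `0`) of the diagram of
Hermitian type; the value `0` means that there is no box at this place. -/
def label : HermitianType → ℕ → ℕ → ℕ
  | A n p _ _, r, c => if r ≤ n - p ∧ c < p then p + r - c else 0
  | B n _, r, c =>
      if r = 0 ∧ c < n then c + 1
      else if 0 < r ∧ r < n ∧ c + 1 = n then n - r
      else 0
  | C n _, r, c => if r ≤ c ∧ c < n then n - (c - r) else 0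
  | DA n _, r, c =>
      if r = c ∧ c + 1 < n then (if Even r then n else n - 1)
      else if r < c ∧ c + 1 < n then n - 1 - (c - r)
      else 0
  | DD n _, r, c =>
      if r = 0 ∧ c + 2 < n then c + 1
      else if r = 0 ∧ c + 2 = n then n
      else if r = 1 ∧ c + 3 = n then n - 1
      else if 0 < r ∧ r + 1 < n ∧ c + 2 = n then n - 1 - r
      else 0
  | E6, r, c =>
      (([[1, 3, 4, 5, 6],
         [0, 0, 2, 4, 5],
         [0, 0, 0, 3, 4, 2],
         [0, 0, 0, 1, 3, 4, 5, 6]] : List (List ℕ)).getD r []).getD c 0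
  | E7, r, c =>
      (([[7, 6, 5, 4, 3, 1],
         [0, 0, 0, 2, 4, 3],
         [0, 0, 0, 0, 5, 4, 2],
         [0, 0, 0, 0, 6, 5, 4, 3, 1],
         [0, 0, 0, 0, 7, 6, 5, 4, 3],
         [0, 0, 0, 0, 0, 0, 0, 2, 4],
         [0, 0, 0, 0, 0, 0, 0, 0, 5],
         [0, 0, 0, 0, 0, 0, 0, 0, 6],
         [0, 0, 0, 0, 0, 0, 0, 0, 7]] : List (List ℕ)).getD r []).getD c 0

/-- A number that bounds the row and the column indices of all boxes. -/
def size : HermitianType → ℕ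
  | A n _ _ _ => n
  | B n _ => n
  | C n _ => n
  | DA n _ => n
  | DD n _ => n
  | E6 => 8
  | E7 => 9

/-- The boxes `(r, c)` of the diagram of Hermitian type, row by row from the top, each row from
left to right. -/
def boxes (T : HermitianType) : List (ℕ × ℕ) :=
  ((List.range T.size) ×ˢ (List.range T.size)).filter fun b => T.label b.1 b.2 ≠ 0

/-- Every labelled place is listed in `boxes`. -/
theorem mem_boxes (T : HermitianType) (b : ℕ × ℕ) : b ∈ T.boxes ↔ T.label b.1 b.2 ≠ 0 := by
  obtain ⟨r, c⟩ := b
  suffices h : T.label r c ≠ 0 → r < T.size ∧ c < T.size by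
    simpa [boxes, List.pair_mem_product] using h
  intro h
  cases T with
  | E6 =>
    rcases lt_or_ge r 4 with hr | hr
    · refine ⟨hr.trans (by decide), lt_of_not_ge fun hc => h ?_⟩
      have hc' : 8 ≤ c := hc
      interval_cases r <;> exact List.getD_eq_default _ _ (by simp; omega)
    · exact absurd (by simp only [label]; rw [List.getD_eq_default _ [] (by simpa using hr)]; rfl) h
  | E7 =>
    rcases lt_or_ge r 9 with hr | hr
    · refine ⟨hr, lt_of_not_ge fun hc => h ?_⟩
      have hc' : 9 ≤ c := hc
      interval_cases r <;> exact List.getD_eq_default _ _ (by simp; omega)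
    · exact absurd (by simp only [label]; rw [List.getD_eq_default _ [] (by simpa using hr)]; rfl) h
  | _ => simp only [label, size] at *; split_ifs at h <;> omega

/-- A subdiagram: a set of boxes which contains with a box every box (of the whole diagram) that
lies weakly above and weakly to the left of it. -/
def IsSubdiagram (T : HermitianType) (M : Finset (ℕ × ℕ)) : Prop :=
  (∀ b ∈ M, b ∈ T.boxes) ∧ ∀ b ∈ M, ∀ c ∈ T.boxes, c.1 ≤ b.1 → c.2 ≤ b.2 → c ∈ M

/-- The labels of the boxes in `M`, read row by row from the top, each row from left to right. -/
def readingWord (T : HermitianType) (M : Finset (ℕ × ℕ)) : List (Fin T.rank) :=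
  (T.boxes.filter fun b => b ∈ M).map fun b => T.index (T.label b.1 b.2)

/-- `M` is the diagram of `w`: it is a subdiagram, and if `r_1, …, r_m` are the products of the
simple reflections along its rows, then `w = (r_1 ⋯ r_m)⁻¹ = r_m⁻¹ ⋯ r_1⁻¹`. -/
def IsDiagramOf (T : HermitianType) {W : Type*} [Group W] (cs : CoxeterSystem T.coxeterMatrix W)
    (M : Finset (ℕ × ℕ)) (w : W) : Prop :=
  T.IsSubdiagram M ∧ w = (cs.wordProd (T.readingWord M))⁻¹

end HermitianType

/-- All boxes of `D` lie in one row. -/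
def InSingleRow (D : Finset (ℕ × ℕ)) : Prop := ∃ r, ∀ b ∈ D, b.1 = r

/-- All boxes of `D` lie in one column. -/
def InSingleColumn (D : Finset (ℕ × ℕ)) : Prop := ∃ c, ∀ b ∈ D, b.2 = c

/-! The fundamental weight `ω` of `T.node` is minuscule for `cartan`, read as `cartan i j = ⟨α_j,
α_i^∨⟩`. Of the two root systems with Weyl group of type `B_n`, the pair `B_n/B_{n-1}` uses `C_n`
(vector weight) and `C_n/A_{n-1}` uses `B_n` (spin weight). Attach to a subdiagram `M` the weight `ω
- ∑ α_{label b}`, the sum being over the boxes `b` of `M`. Its value at the coroot of `i` is `1` if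
a box labelled `i` can be added, `-1` if one can be removed, and `0` otherwise (`weight_count`).
Hence `s_i` adds a box, removes a box or fixes the weight.

Consequently the element `w` of `M` sends `ω` to the weight of `M`, has length `M.card`, and has `i`
as a left descent exactly when the value at `i` is `-1`. If the value is `0`, then `s_i w = w s_j`
with `j ∈ J`, so `s_i w ∉ W^J` (`exists_simple_mul_element_eq`). Deodhar's three cases are thus read
off from the value of the weight of `u` at a descent of `v`.

Along a row or a column the labels are distinct and form a connected set `K` in the Coxeter graph.
The recursion does not preserve lines, so the induction keeps only this: the weights of `u` and `v`
differ by the sum of the simple roots of a connected set `K`. For a left descent `i` of `v`, the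
value of the weight of `u` at `i` is `-1 + ∑_{j ∈ K} cartan i j`. If `i ∉ K`, off-diagonal entries
being nonpositive, it is `-1`; the box is removed on both sides and `K` is unchanged. If `i ∈ K`, it
is `1 + ∑_{j ∈ K, j ≠ i} cartan i j`. The value `1` forces `K = {i}` and gives `q - 1`; the value
`0` makes `i` a leaf of `K` and contributes a factor `q`, with `K` replaced by the connected set `K
\ {i}`; the value `-1` again leaves `K` unchanged. The result is `(q - 1) q^(|K| - 1)`. -/

namespace HermitianType

/-- Whether the long simple root is the last one. -/
def lastLong : HermitianType → Bool
  | C _ _ => true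
  | _ => false

/-- The Cartan matrix for which the fundamental weight of `T.node` is minuscule. -/
def cartan (T : HermitianType) (i j : Fin T.rank) : ℤ :=
  if i = j then 2
  else if T.coxeterMatrix i j = 2 then 0
  else if T.coxeterMatrix i j = 3 then -1
  else if (T.lastLong = true ↔ (i : ℕ) < j) then -1
  else -2

/-! ### Coxeter matrices and labels in the infinite families -/

theorem coxeterMatrix_A_apply {n p : ℕ} {hp : 1 ≤ p} {hpn : p ≤ n}
    (i j : Fin (A n p hp hpn).rank) : (A n p hp hpn).coxeterMatrix i j =
      if (i : ℕ) = j then 1 else if (j : ℕ) + 1 = i ∨ (i : ℕ) + 1 = j then 3 else 2 := by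
  simp only [← Fin.ext_iff]; rfl

theorem coxeterMatrix_B_apply {n : ℕ} {hn : 2 ≤ n} (i j : Fin (B n hn).rank) :
    (B n hn).coxeterMatrix i j =
      if (i : ℕ) = j then 1
      else if (i : ℕ) = n - 1 ∧ (j : ℕ) = n - 2 ∨ (j : ℕ) = n - 1 ∧ (i : ℕ) = n - 2 then 4
      else if (j : ℕ) + 1 = i ∨ (i : ℕ) + 1 = j then 3 else 2 := by
  simp only [← Fin.ext_iff]; rfl

theorem coxeterMatrix_C_apply {n : ℕ} {hn : 2 ≤ n} (i j : Fin (C n hn).rank) :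
    (C n hn).coxeterMatrix i j =
      if (i : ℕ) = j then 1
      else if (i : ℕ) = n - 1 ∧ (j : ℕ) = n - 2 ∨ (j : ℕ) = n - 1 ∧ (i : ℕ) = n - 2 then 4
      else if (j : ℕ) + 1 = i ∨ (i : ℕ) + 1 = j then 3 else 2 := by
  simp only [← Fin.ext_iff]; rfl

theorem coxeterMatrix_DA_apply {n : ℕ} {hn : 3 ≤ n} (i j : Fin (DA n hn).rank) :
    (DA n hn).coxeterMatrix i j =
      if (i : ℕ) = j then 1
      else if ((i : ℕ) + 1 = j ∧ (j : ℕ) + 1 < n) ∨ ((j : ℕ) + 1 = i ∧ (i : ℕ) + 1 < n) ∨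
        ((i : ℕ) + 2 = j ∧ (j : ℕ) + 1 = n) ∨ ((j : ℕ) + 2 = i ∧ (i : ℕ) + 1 = n) then 3
      else 2 := by
  simp only [← Fin.ext_iff]; rfl

theorem coxeterMatrix_DD_apply {n : ℕ} {hn : 3 ≤ n} (i j : Fin (DD n hn).rank) :
    (DD n hn).coxeterMatrix i j =
      if (i : ℕ) = j then 1
      else if ((i : ℕ) + 1 = j ∧ (j : ℕ) + 1 < n) ∨ ((j : ℕ) + 1 = i ∧ (i : ℕ) + 1 < n) ∨
        ((i : ℕ) + 2 = j ∧ (j : ℕ) + 1 = n) ∨ ((j : ℕ) + 2 = i ∧ (i : ℕ) + 1 = n) then 3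
      else 2 := by
  simp only [← Fin.ext_iff]; rfl

theorem label_A_iff {n p : ℕ} (hp : 1 ≤ p) (hpn : p ≤ n) (r c i : ℕ) :
    (A n p hp hpn).label r c = i + 1 ↔ r ≤ n - p ∧ c < p ∧ p + r = c + i + 1 := by
  simp only [label]; split_ifs <;> (try rw [false_iff]) <;> omega

theorem label_B_iff {n : ℕ} (hn : 2 ≤ n) (r c i : ℕ) :
    (B n hn).label r c = i + 1 ↔
      r = 0 ∧ c < n ∧ i = c ∨ 0 < r ∧ r < n ∧ c + 1 = n ∧ i + 1 + r = n := by
  simp only [label]; split_ifs <;> (try rw [false_iff]) <;> omega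

theorem label_C_iff {n : ℕ} (hn : 2 ≤ n) (r c i : ℕ) :
    (C n hn).label r c = i + 1 ↔ r ≤ c ∧ c < n ∧ i + 1 + c = n + r := by
  simp only [label]; split_ifs <;> (try rw [false_iff]) <;> omega

theorem label_DA_iff {n : ℕ} (hn : 3 ≤ n) (r c i : ℕ) :
    (DA n hn).label r c = i + 1 ↔
      r = c ∧ c + 1 < n ∧ (r % 2 = 0 ∧ i + 1 = n ∨ r % 2 = 1 ∧ i + 2 = n) ∨
      r < c ∧ c + 1 < n ∧ i + 2 + c = n + r := by
  simp only [label, Nat.even_iff]; split_ifs <;> (try rw [false_iff]) <;> omega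

theorem label_DD_iff {n : ℕ} (hn : 3 ≤ n) (r c i : ℕ) :
    (DD n hn).label r c = i + 1 ↔
      r = 0 ∧ c + 2 < n ∧ i = c ∨ r = 0 ∧ c + 2 = n ∧ i + 1 = n ∨
      r = 1 ∧ c + 3 = n ∧ i + 2 = n ∨ 0 < r ∧ r + 1 < n ∧ c + 2 = n ∧ i + 2 + r = n := by
  simp only [label]; split_ifs <;> (try rw [false_iff]) <;> omega

theorem label_A_ne {n p : ℕ} (hp : 1 ≤ p) (hpn : p ≤ n) (r c : ℕ) :
    (A n p hp hpn).label r c ≠ 0 ↔ r ≤ n - p ∧ c < p := by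
  simp only [label]; split_ifs <;> omega

theorem label_B_ne {n : ℕ} (hn : 2 ≤ n) (r c : ℕ) :
    (B n hn).label r c ≠ 0 ↔ r = 0 ∧ c < n ∨ 0 < r ∧ r < n ∧ c + 1 = n := by
  simp only [label]; split_ifs <;> omega

theorem label_C_ne {n : ℕ} (hn : 2 ≤ n) (r c : ℕ) :
    (C n hn).label r c ≠ 0 ↔ r ≤ c ∧ c < n := by
  simp only [label]; split_ifs <;> omega

theorem label_DA_ne {n : ℕ} (hn : 3 ≤ n) (r c : ℕ) :
    (DA n hn).label r c ≠ 0 ↔ r ≤ c ∧ c + 1 < n := by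
  simp only [label]; split_ifs <;> omega

theorem label_DD_ne {n : ℕ} (hn : 3 ≤ n) (r c : ℕ) :
    (DD n hn).label r c ≠ 0 ↔
      r = 0 ∧ c + 1 < n ∨ r = 1 ∧ c + 3 = n ∨ 0 < r ∧ r + 1 < n ∧ c + 2 = n := by
  simp only [label]; split_ifs <;> omega

/-! ### Order and commutation of boxes -/

theorem lt_size {T : HermitianType} {r c : ℕ} (h : T.label r c ≠ 0) : r < T.size ∧ c < T.size := by
  have := (T.mem_boxes (r, c)).2 h
  simpa using List.pair_mem_product.1 (List.mem_filter.1 this).1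

theorem label_le_rank (T : HermitianType) (r c : ℕ) : T.label r c ≤ T.rank := by
  by_cases h : T.label r c = 0
  · omega
  cases T with
  | E6 =>
    obtain ⟨h1, h2⟩ := lt_size h
    have : ∀ r < 8, ∀ c < 8, E6.label r c ≤ 6 := by decide
    exact this r h1 c h2
  | E7 =>
    obtain ⟨h1, h2⟩ := lt_size h
    have : ∀ r < 9, ∀ c < 9, E7.label r c ≤ 7 := by decide
    exact this r h1 c h2
  | _ => simp only [label, rank] at *; split_ifs <;> omega

theorem exists_label_eq {T : HermitianType} {r c : ℕ} (h : T.label r c ≠ 0) :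
    ∃ i : Fin T.rank, T.label r c = i + 1 :=
  ⟨⟨T.label r c - 1, by have := T.label_le_rank r c; omega⟩, by simp only; omega⟩

/-- Comparable boxes are joined by unit steps through boxes of the diagram. This makes it enough to
test closure of a subdiagram at the immediate left and upper neighbours. -/
theorem exists_predecessor {T : HermitianType} {r c r' c' : ℕ} (h : T.label r c ≠ 0)
    (h' : T.label r' c' ≠ 0) (hr : r ≤ r') (hc : c ≤ c') (hne : r < r' ∨ c < c') :
    (c < c' ∧ T.label r' (c' - 1) ≠ 0) ∨ (r < r' ∧ T.label (r' - 1) c' ≠ 0) := by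
  cases T with
  | E6 =>
    obtain ⟨h1, h2⟩ := lt_size h
    obtain ⟨h3, h4⟩ := lt_size h'
    have : ∀ r c : Fin 8, E6.label r c ≠ 0 → ∀ r' c' : Fin 8, E6.label r' c' ≠ 0 → r ≤ r' →
        c ≤ c' → (r < r' ∨ c < c') → (c < c' ∧ E6.label r' (c' - 1) ≠ 0) ∨
          (r < r' ∧ E6.label (r' - 1) c' ≠ 0) := by decide +kernel
    exact this ⟨r, h1⟩ ⟨c, h2⟩ h ⟨r', h3⟩ ⟨c', h4⟩ h' hr hc hne
  | E7 =>
    obtain ⟨h1, h2⟩ := lt_size h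
    obtain ⟨h3, h4⟩ := lt_size h'
    have : ∀ r c : Fin 9, E7.label r c ≠ 0 → ∀ r' c' : Fin 9, E7.label r' c' ≠ 0 → r ≤ r' →
        c ≤ c' → (r < r' ∨ c < c') → (c < c' ∧ E7.label r' (c' - 1) ≠ 0) ∨
          (r < r' ∧ E7.label (r' - 1) c' ≠ 0) := by decide +kernel
    exact this ⟨r, h1⟩ ⟨c, h2⟩ h ⟨r', h3⟩ ⟨c', h4⟩ h' hr hc hne
  | A => simp only [label_A_ne] at *; omega
  | B => simp only [label_B_ne] at *; omega
  | C => simp only [label_C_ne] at *; omega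
  | DA => simp only [label_DA_ne] at *; omega
  | DD => simp only [label_DD_ne] at *; omega

/-- This is what makes the order of reading immaterial, and it forces boxes with equal labels to
form a chain. -/
theorem commute_of_incomparable {T : HermitianType} {r c r' c' : ℕ} (hr : r < r') (hc : c' < c)
    {i j : Fin T.rank} (hi : T.label r c = i + 1) (hj : T.label r' c' = j + 1) :
    T.coxeterMatrix i j = 2 := by
  cases T with
  | E6 =>
    obtain ⟨h1, h2⟩ := lt_size (T := E6) (r := r) (c := c) (by omega)
    obtain ⟨h3, h4⟩ := lt_size (T := E6) (r := r') (c := c') (by omega)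
    have : ∀ r r' : Fin 8, r < r' → ∀ c' c : Fin 8, c' < c → E6.label r c ≠ 0 →
        E6.label r' c' ≠ 0 → E6.coxeterMatrix (E6.index (E6.label r c))
          (E6.index (E6.label r' c')) = 2 := by decide +kernel
    have := this ⟨r, h1⟩ ⟨r', h3⟩ hr ⟨c', h4⟩ ⟨c, h2⟩ hc (by simp [hi]) (by simp [hj])
    simpa [hi, hj, index, Nat.mod_eq_of_lt i.2, Nat.mod_eq_of_lt j.2] using this
  | E7 =>
    obtain ⟨h1, h2⟩ := lt_size (T := E7) (r := r) (c := c) (by omega)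
    obtain ⟨h3, h4⟩ := lt_size (T := E7) (r := r') (c := c') (by omega)
    have : ∀ r r' : Fin 9, r < r' → ∀ c' c : Fin 9, c' < c → E7.label r c ≠ 0 →
        E7.label r' c' ≠ 0 → E7.coxeterMatrix (E7.index (E7.label r c))
          (E7.index (E7.label r' c')) = 2 := by decide +kernel
    have := this ⟨r, h1⟩ ⟨r', h3⟩ hr ⟨c', h4⟩ ⟨c, h2⟩ hc (by simp [hi]) (by simp [hj])
    simpa [hi, hj, index, Nat.mod_eq_of_lt i.2, Nat.mod_eq_of_lt j.2] using this
  | A =>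
    simp only [label_A_iff] at hi hj
    rw [coxeterMatrix_A_apply]
    split_ifs <;> omega
  | B =>
    simp only [label_B_iff] at hi hj
    rw [coxeterMatrix_B_apply]
    split_ifs <;> omega
  | C =>
    simp only [label_C_iff] at hi hj
    rw [coxeterMatrix_C_apply]
    split_ifs <;> omega
  | DA =>
    simp only [label_DA_iff] at hi hj
    rw [coxeterMatrix_DA_apply]
    split_ifs <;> omega
  | DD =>
    simp only [label_DD_iff] at hi hj
    rw [coxeterMatrix_DD_apply]
    split_ifs <;> omega

theorem eq_of_label_eq_of_row {T : HermitianType} {r c c' : ℕ} (h : T.label r c ≠ 0)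
    (h' : T.label r c = T.label r c') : c = c' := by
  cases T with
  | E6 =>
    obtain ⟨h1, h2⟩ := lt_size h
    obtain ⟨h3, h4⟩ := lt_size (h' ▸ h)
    have : ∀ r < 8, ∀ c < 8, ∀ c' < 8, E6.label r c ≠ 0 → E6.label r c = E6.label r c' → c = c' := by
      decide +kernel
    exact this r h1 c h2 c' h4 h h'
  | E7 =>
    obtain ⟨h1, h2⟩ := lt_size h
    obtain ⟨h3, h4⟩ := lt_size (h' ▸ h)
    have : ∀ r < 9, ∀ c < 9, ∀ c' < 9, E7.label r c ≠ 0 → E7.label r c = E7.label r c' → c = c' := by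
      decide +kernel
    exact this r h1 c h2 c' h4 h h'
  | _ => simp only [label] at h h'; split_ifs at h h' <;> omega

theorem eq_of_label_eq_of_column {T : HermitianType} {r r' c : ℕ} (h : T.label r c ≠ 0)
    (h' : T.label r c = T.label r' c) : r = r' := by
  cases T with
  | E6 =>
    obtain ⟨h1, h2⟩ := lt_size h
    obtain ⟨h3, h4⟩ := lt_size (h' ▸ h)
    have : ∀ r < 8, ∀ r' < 8, ∀ c < 8, E6.label r c ≠ 0 → E6.label r c = E6.label r' c → r = r' := by
      decide +kernel
    exact this r h1 r' h3 c h2 h h'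
  | E7 =>
    obtain ⟨h1, h2⟩ := lt_size h
    obtain ⟨h3, h4⟩ := lt_size (h' ▸ h)
    have : ∀ r < 9, ∀ r' < 9, ∀ c < 9, E7.label r c ≠ 0 → E7.label r c = E7.label r' c → r = r' := by
      decide +kernel
    exact this r h1 r' h3 c h2 h h'
  | _ => simp only [label] at h h'; split_ifs at h h' <;> omega

theorem label_zero_zero (T : HermitianType) : T.label 0 0 = T.node := by
  cases T <;> simp only [label, node] <;> (try split_ifs) <;>
    first | rfl | omega | (simp at *; done) | (simp at *; omega)

/-! ### Cartan integers as neighbour counts -/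

theorem cartan_A_apply {n p : ℕ} {hp : 1 ≤ p} {hpn : p ≤ n} (i j : Fin (A n p hp hpn).rank) :
    (A n p hp hpn).cartan i j =
      if (i : ℕ) = j then 2
      else if (j : ℕ) + 1 = i ∨ (i : ℕ) + 1 = j then -1
      else 0 := by
  simp only [cartan, coxeterMatrix_A_apply, lastLong, Fin.ext_iff, Bool.false_eq_true,
    false_iff]
  split_ifs <;> first | rfl | omega

theorem cartan_B_apply {n : ℕ} {hn : 2 ≤ n} (i j : Fin (B n hn).rank) :
    (B n hn).cartan i j =
      if (i : ℕ) = j then 2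
      else if (i : ℕ) + 2 = n ∧ (j : ℕ) + 1 = n then -2
      else if (j : ℕ) + 1 = i ∨ (i : ℕ) + 1 = j then -1
      else 0 := by
  simp only [cartan, coxeterMatrix_B_apply, lastLong, Fin.ext_iff, Bool.false_eq_true,
    false_iff]
  split_ifs <;> first | rfl | omega

theorem cartan_C_apply {n : ℕ} {hn : 2 ≤ n} (i j : Fin (C n hn).rank) :
    (C n hn).cartan i j =
      if (i : ℕ) = j then 2
      else if (j : ℕ) + 2 = n ∧ (i : ℕ) + 1 = n then -2
      else if (j : ℕ) + 1 = i ∨ (i : ℕ) + 1 = j then -1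
      else 0 := by
  simp only [cartan, coxeterMatrix_C_apply, lastLong, Fin.ext_iff, true_iff]
  split_ifs <;> first | rfl | omega

theorem cartan_DA_apply {n : ℕ} {hn : 3 ≤ n} (i j : Fin (DA n hn).rank) :
    (DA n hn).cartan i j =
      if (i : ℕ) = j then 2
      else if ((i : ℕ) + 1 = j ∧ (j : ℕ) + 1 < n) ∨ ((j : ℕ) + 1 = i ∧ (i : ℕ) + 1 < n) ∨
        ((i : ℕ) + 2 = j ∧ (j : ℕ) + 1 = n) ∨ ((j : ℕ) + 2 = i ∧ (i : ℕ) + 1 = n) then -1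
      else 0 := by
  simp only [cartan, coxeterMatrix_DA_apply, lastLong, Fin.ext_iff, Bool.false_eq_true,
    false_iff]
  split_ifs <;> first | rfl | omega

theorem cartan_DD_apply {n : ℕ} {hn : 3 ≤ n} (i j : Fin (DD n hn).rank) :
    (DD n hn).cartan i j =
      if (i : ℕ) = j then 2
      else if ((i : ℕ) + 1 = j ∧ (j : ℕ) + 1 < n) ∨ ((j : ℕ) + 1 = i ∧ (i : ℕ) + 1 < n) ∨
        ((i : ℕ) + 2 = j ∧ (j : ℕ) + 1 = n) ∨ ((j : ℕ) + 2 = i ∧ (i : ℕ) + 1 = n) then -1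
      else 0 := by
  simp only [cartan, coxeterMatrix_DD_apply, lastLong, Fin.ext_iff, Bool.false_eq_true,
    false_iff]
  split_ifs <;> first | rfl | omega

/-- Serves to replace the four neighbour conditions by short arithmetic ones before the case split
on the Cartan entry, in types `B` and `D`. -/
theorem neighbour_sum_congr {a b d e a' b' d' e' : Prop} [Decidable a] [Decidable b] [Decidable d]
    [Decidable e] [Decidable a'] [Decidable b'] [Decidable d'] [Decidable e']
    (ha : a ↔ a') (hb : b ↔ b') (hd : d ↔ d') (he : e ↔ e') :
    (if a then 1 else 0) + (if b then 1 else 0) + (if d then 1 else 0) + (if e then 1 else 0) =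
      (if a' then 1 else 0) + (if b' then 1 else 0) + (if d' then 1 else 0) +
        (if e' then (1 : ℤ) else 0) := by
  simp only [ha, hb, hd, he]

theorem cartan_A_eq {n p : ℕ} {hp : 1 ≤ p} {hpn : p ≤ n} {r c : ℕ} {i j : Fin (A n p hp hpn).rank}
    (hj : (A n p hp hpn).label r c = j + 1) (hij : ¬(i : ℕ) = j) :
    ((0 < c ∧ (A n p hp hpn).label (r + 1) (c - 1) ≠ 0) →
          (0 < c ∧ (A n p hp hpn).label r (c - 1) = i + 1 ↔ (A n p hp hpn).label (r + 1) c = i + 1)) ∧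
      ((0 < r ∧ (A n p hp hpn).label (r - 1) (c + 1) ≠ 0) →
          (0 < r ∧ (A n p hp hpn).label (r - 1) c = i + 1 ↔ (A n p hp hpn).label r (c + 1) = i + 1)) ∧
      (A n p hp hpn).cartan i j = - ((if 0 < c ∧ (A n p hp hpn).label r (c - 1) = i + 1 then 1 else 0) +
        (if 0 < r ∧ (A n p hp hpn).label (r - 1) c = i + 1 then 1 else 0) +
        (if (A n p hp hpn).label (r + 1) c = i + 1 ∧ ¬ (0 < c ∧ (A n p hp hpn).label (r + 1) (c - 1) ≠ 0)
          then 1 else 0) +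
        (if (A n p hp hpn).label r (c + 1) = i + 1 ∧ ¬ (0 < r ∧ (A n p hp hpn).label (r - 1) (c + 1) ≠ 0)
          then 1 else 0)) := by
  simp only [label_A_iff, label_A_ne, cartan_A_apply] at hj ⊢
  have h1 : (i : ℕ) < n := i.isLt
  have h2 : (j : ℕ) < n := j.isLt
  generalize (i : ℕ) = i at *
  generalize (j : ℕ) = j at *
  refine ⟨by omega, by omega, ?_⟩
  split_ifs <;> first | rfl | omega

theorem cartan_B_eq {n : ℕ} {hn : 2 ≤ n} {r c : ℕ} {i j : Fin (B n hn).rank}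
    (hj : (B n hn).label r c = j + 1) (hij : ¬(i : ℕ) = j) :
    ((0 < c ∧ (B n hn).label (r + 1) (c - 1) ≠ 0) →
          (0 < c ∧ (B n hn).label r (c - 1) = i + 1 ↔ (B n hn).label (r + 1) c = i + 1)) ∧
      ((0 < r ∧ (B n hn).label (r - 1) (c + 1) ≠ 0) →
          (0 < r ∧ (B n hn).label (r - 1) c = i + 1 ↔ (B n hn).label r (c + 1) = i + 1)) ∧
      (B n hn).cartan i j = - ((if 0 < c ∧ (B n hn).label r (c - 1) = i + 1 then 1 else 0) +
        (if 0 < r ∧ (B n hn).label (r - 1) c = i + 1 then 1 else 0) +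
        (if (B n hn).label (r + 1) c = i + 1 ∧ ¬ (0 < c ∧ (B n hn).label (r + 1) (c - 1) ≠ 0)
          then 1 else 0) +
        (if (B n hn).label r (c + 1) = i + 1 ∧ ¬ (0 < r ∧ (B n hn).label (r - 1) (c + 1) ≠ 0)
          then 1 else 0)) := by
  simp only [label_B_iff, label_B_ne, cartan_B_apply] at hj ⊢
  have h1 : (i : ℕ) < n := i.isLt
  have h2 : (j : ℕ) < n := j.isLt
  generalize (i : ℕ) = i at *
  generalize (j : ℕ) = j at *
  refine ⟨by omega, by omega, ?_⟩
  rcases hj with hj | hj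
  · rw [neighbour_sum_congr (a' := i + 1 = j)
      (b' := False)
      (d' := c + 1 = n ∧ i + 2 = n)
      (e' := i = j + 1)
      (by omega) (iff_false_intro (by omega)) (by omega) (by omega)]
    simp only [↓reduceIte]
    split_ifs <;> first | rfl | omega
  · rw [neighbour_sum_congr (a' := False)
      (b' := i = j + 1)
      (d' := i + 1 = j)
      (e' := False)
      (iff_false_intro (by omega)) (by omega) (by omega) (iff_false_intro (by omega))]
    simp only [↓reduceIte]
    split_ifs <;> first | rfl | omega

theorem cartan_C_eq {n : ℕ} {hn : 2 ≤ n} {r c : ℕ} {i j : Fin (C n hn).rank}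
    (hj : (C n hn).label r c = j + 1) (hij : ¬(i : ℕ) = j) :
    ((0 < c ∧ (C n hn).label (r + 1) (c - 1) ≠ 0) →
          (0 < c ∧ (C n hn).label r (c - 1) = i + 1 ↔ (C n hn).label (r + 1) c = i + 1)) ∧
      ((0 < r ∧ (C n hn).label (r - 1) (c + 1) ≠ 0) →
          (0 < r ∧ (C n hn).label (r - 1) c = i + 1 ↔ (C n hn).label r (c + 1) = i + 1)) ∧
      (C n hn).cartan i j = - ((if 0 < c ∧ (C n hn).label r (c - 1) = i + 1 then 1 else 0) +
        (if 0 < r ∧ (C n hn).label (r - 1) c = i + 1 then 1 else 0) +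
        (if (C n hn).label (r + 1) c = i + 1 ∧ ¬ (0 < c ∧ (C n hn).label (r + 1) (c - 1) ≠ 0)
          then 1 else 0) +
        (if (C n hn).label r (c + 1) = i + 1 ∧ ¬ (0 < r ∧ (C n hn).label (r - 1) (c + 1) ≠ 0)
          then 1 else 0)) := by
  simp only [label_C_iff, label_C_ne, cartan_C_apply] at hj ⊢
  have h1 : (i : ℕ) < n := i.isLt
  have h2 : (j : ℕ) < n := j.isLt
  generalize (i : ℕ) = i at *
  generalize (j : ℕ) = j at *
  refine ⟨by omega, by omega, ?_⟩
  split_ifs <;> first | rfl | omega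

theorem cartan_DA_eq {n : ℕ} {hn : 3 ≤ n} {r c : ℕ} {i j : Fin (DA n hn).rank}
    (hj : (DA n hn).label r c = j + 1) (hij : ¬(i : ℕ) = j) :
    ((0 < c ∧ (DA n hn).label (r + 1) (c - 1) ≠ 0) →
          (0 < c ∧ (DA n hn).label r (c - 1) = i + 1 ↔ (DA n hn).label (r + 1) c = i + 1)) ∧
      ((0 < r ∧ (DA n hn).label (r - 1) (c + 1) ≠ 0) →
          (0 < r ∧ (DA n hn).label (r - 1) c = i + 1 ↔ (DA n hn).label r (c + 1) = i + 1)) ∧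
      (DA n hn).cartan i j = - ((if 0 < c ∧ (DA n hn).label r (c - 1) = i + 1 then 1 else 0) +
        (if 0 < r ∧ (DA n hn).label (r - 1) c = i + 1 then 1 else 0) +
        (if (DA n hn).label (r + 1) c = i + 1 ∧ ¬ (0 < c ∧ (DA n hn).label (r + 1) (c - 1) ≠ 0)
          then 1 else 0) +
        (if (DA n hn).label r (c + 1) = i + 1 ∧ ¬ (0 < r ∧ (DA n hn).label (r - 1) (c + 1) ≠ 0)
          then 1 else 0)) := by
  simp only [label_DA_iff, label_DA_ne, cartan_DA_apply] at hj ⊢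
  have h1 : (i : ℕ) < n := i.isLt
  have h2 : (j : ℕ) < n := j.isLt
  generalize (i : ℕ) = i at *
  generalize (j : ℕ) = j at *
  refine ⟨by omega, by omega, ?_⟩
  rcases hj with ⟨hj, hj', hj'' | hj''⟩ | hj
  · rw [neighbour_sum_congr (a' := False)
      (b' := 0 < r ∧ i + 3 = n)
      (d' := False)
      (e' := r = 0 ∧ i + 3 = n)
      (iff_false_intro (by omega)) (by omega) (iff_false_intro (by omega)) (by omega)]
    simp only [↓reduceIte]
    split_ifs <;> first | rfl | omega
  · rw [neighbour_sum_congr (a' := False)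
      (b' := i + 3 = n)
      (d' := False)
      (e' := False)
      (iff_false_intro (by omega)) (by omega) (iff_false_intro (by omega)) (iff_false_intro (by omega))]
    simp only [↓reduceIte]
    split_ifs <;> first | rfl | omega
  · rw [neighbour_sum_congr
      (a' := c = r + 1 ∧ (r % 2 = 0 ∧ i + 1 = n ∨ r % 2 = 1 ∧ i + 2 = n) ∨
        r + 1 < c ∧ i = j + 1)
      (b' := 0 < r ∧ i + 1 = j)
      (d' := c = r + 1 ∧ (r % 2 = 0 ∧ i + 2 = n ∨ r % 2 = 1 ∧ i + 1 = n))
      (e' := r = 0 ∧ i + 1 = j)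
      (by omega) (by omega) (by omega) (by omega)]
    split_ifs <;> first | rfl | omega

theorem cartan_DD_eq {n : ℕ} {hn : 3 ≤ n} {r c : ℕ} {i j : Fin (DD n hn).rank}
    (hj : (DD n hn).label r c = j + 1) (hij : ¬(i : ℕ) = j) :
    ((0 < c ∧ (DD n hn).label (r + 1) (c - 1) ≠ 0) →
          (0 < c ∧ (DD n hn).label r (c - 1) = i + 1 ↔ (DD n hn).label (r + 1) c = i + 1)) ∧
      ((0 < r ∧ (DD n hn).label (r - 1) (c + 1) ≠ 0) →
          (0 < r ∧ (DD n hn).label (r - 1) c = i + 1 ↔ (DD n hn).label r (c + 1) = i + 1)) ∧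
      (DD n hn).cartan i j = - ((if 0 < c ∧ (DD n hn).label r (c - 1) = i + 1 then 1 else 0) +
        (if 0 < r ∧ (DD n hn).label (r - 1) c = i + 1 then 1 else 0) +
        (if (DD n hn).label (r + 1) c = i + 1 ∧ ¬ (0 < c ∧ (DD n hn).label (r + 1) (c - 1) ≠ 0)
          then 1 else 0) +
        (if (DD n hn).label r (c + 1) = i + 1 ∧ ¬ (0 < r ∧ (DD n hn).label (r - 1) (c + 1) ≠ 0)
          then 1 else 0)) := by
  simp only [label_DD_iff, label_DD_ne, cartan_DD_apply] at hj ⊢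
  have h1 : (i : ℕ) < n := i.isLt
  have h2 : (j : ℕ) < n := j.isLt
  generalize (i : ℕ) = i at *
  generalize (j : ℕ) = j at *
  refine ⟨by omega, by omega, ?_⟩
  rcases hj with hj | hj | hj | hj
  · rw [neighbour_sum_congr (a' := i + 1 = j)
      (b' := False)
      (d' := c + 3 = n ∧ i + 2 = n)
      (e' := c + 3 < n ∧ i = j + 1 ∨ c + 3 = n ∧ i + 1 = n)
      (by omega) (iff_false_intro (by omega)) (by omega) (by omega)]
    simp only [↓reduceIte]
    split_ifs <;> first | rfl | omega
  · rw [neighbour_sum_congr (a' := i + 3 = n)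
      (b' := False)
      (d' := False)
      (e' := False)
      (by omega) (iff_false_intro (by omega)) (iff_false_intro (by omega)) (iff_false_intro (by omega))]
    simp only [↓reduceIte]
    split_ifs <;> first | rfl | omega
  · rw [neighbour_sum_congr (a' := False)
      (b' := i + 3 = n)
      (d' := False)
      (e' := False)
      (iff_false_intro (by omega)) (by omega) (iff_false_intro (by omega)) (iff_false_intro (by omega))]
    simp only [↓reduceIte]
    split_ifs <;> first | rfl | omega
  · rw [neighbour_sum_congr (a' := r = 1 ∧ i + 2 = n)
      (b' := r = 1 ∧ i + 1 = n ∨ 2 ≤ r ∧ i = j + 1)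
      (d' := i + 1 = j)
      (e' := False)
      (by omega) (by omega) (by omega) (iff_false_intro (by omega))]
    simp only [↓reduceIte]
    split_ifs <;> first | rfl | omega

/-- For `i ≠ j`, the Cartan integer counts the boxes labelled `i` next to a box labelled `j`,
where two opposite corners of a common square are counted once. -/
theorem cartan_eq_neg_neighbours {T : HermitianType} {r c : ℕ} {i j : Fin T.rank}
    (hj : T.label r c = j + 1) (hij : i ≠ j) :
    ((0 < c ∧ T.label (r + 1) (c - 1) ≠ 0) →
          (0 < c ∧ T.label r (c - 1) = i + 1 ↔ T.label (r + 1) c = i + 1)) ∧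
      ((0 < r ∧ T.label (r - 1) (c + 1) ≠ 0) →
          (0 < r ∧ T.label (r - 1) c = i + 1 ↔ T.label r (c + 1) = i + 1)) ∧
      T.cartan i j = - ((if 0 < c ∧ T.label r (c - 1) = i + 1 then 1 else 0) +
        (if 0 < r ∧ T.label (r - 1) c = i + 1 then 1 else 0) +
        (if T.label (r + 1) c = i + 1 ∧ ¬ (0 < c ∧ T.label (r + 1) (c - 1) ≠ 0)
          then 1 else 0) +
        (if T.label r (c + 1) = i + 1 ∧ ¬ (0 < r ∧ T.label (r - 1) (c + 1) ≠ 0)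
          then 1 else 0)) := by
  rw [ne_eq, Fin.ext_iff] at hij
  cases T with
  | E6 =>
    obtain ⟨h1, h2⟩ := lt_size (T := E6) (r := r) (c := c) (by omega)
    have key : ∀ i j : Fin 6, ¬(i : ℕ) = j → ∀ r c : Fin 8, E6.label r c = j + 1 →
      ((0 < c ∧ E6.label ((r : ℕ) + 1) ((c : ℕ) - 1) ≠ 0) →
          (0 < c ∧ E6.label r ((c : ℕ) - 1) = i + 1 ↔ E6.label ((r : ℕ) + 1) c = i + 1)) ∧
      ((0 < r ∧ E6.label ((r : ℕ) - 1) ((c : ℕ) + 1) ≠ 0) →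
          (0 < r ∧ E6.label ((r : ℕ) - 1) c = i + 1 ↔ E6.label r ((c : ℕ) + 1) = i + 1)) ∧
      E6.cartan i j = - ((if 0 < c ∧ E6.label r ((c : ℕ) - 1) = i + 1 then 1 else 0) +
        (if 0 < r ∧ E6.label ((r : ℕ) - 1) c = i + 1 then 1 else 0) +
        (if E6.label ((r : ℕ) + 1) c = i + 1 ∧ ¬ (0 < c ∧ E6.label ((r : ℕ) + 1) ((c : ℕ) - 1) ≠ 0)
          then 1 else 0) +
        (if E6.label r ((c : ℕ) + 1) = i + 1 ∧ ¬ (0 < r ∧ E6.label ((r : ℕ) - 1) ((c : ℕ) + 1) ≠ 0)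
          then 1 else 0)) := by
      decide +kernel
    exact key i j hij ⟨r, h1⟩ ⟨c, h2⟩ hj
  | E7 =>
    obtain ⟨h1, h2⟩ := lt_size (T := E7) (r := r) (c := c) (by omega)
    have key : ∀ i j : Fin 7, ¬(i : ℕ) = j → ∀ r c : Fin 9, E7.label r c = j + 1 →
      ((0 < c ∧ E7.label ((r : ℕ) + 1) ((c : ℕ) - 1) ≠ 0) →
          (0 < c ∧ E7.label r ((c : ℕ) - 1) = i + 1 ↔ E7.label ((r : ℕ) + 1) c = i + 1)) ∧
      ((0 < r ∧ E7.label ((r : ℕ) - 1) ((c : ℕ) + 1) ≠ 0) →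
          (0 < r ∧ E7.label ((r : ℕ) - 1) c = i + 1 ↔ E7.label r ((c : ℕ) + 1) = i + 1)) ∧
      E7.cartan i j = - ((if 0 < c ∧ E7.label r ((c : ℕ) - 1) = i + 1 then 1 else 0) +
        (if 0 < r ∧ E7.label ((r : ℕ) - 1) c = i + 1 then 1 else 0) +
        (if E7.label ((r : ℕ) + 1) c = i + 1 ∧ ¬ (0 < c ∧ E7.label ((r : ℕ) + 1) ((c : ℕ) - 1) ≠ 0)
          then 1 else 0) +
        (if E7.label r ((c : ℕ) + 1) = i + 1 ∧ ¬ (0 < r ∧ E7.label ((r : ℕ) - 1) ((c : ℕ) + 1) ≠ 0)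
          then 1 else 0)) := by
      decide +kernel
    exact key i j hij ⟨r, h1⟩ ⟨c, h2⟩ hj
  | A => exact cartan_A_eq hj hij
  | B => exact cartan_B_eq hj hij
  | C => exact cartan_C_eq hj hij
  | DA => exact cartan_DA_eq hj hij
  | DD => exact cartan_DD_eq hj hij

/-! ### Cartan integers and bonds of the Coxeter graph -/

theorem cartan_self (T : HermitianType) (i : Fin T.rank) : T.cartan i i = 2 := if_pos rfl

theorem coxeterMatrix_mem (T : HermitianType) {i j : Fin T.rank} (h : i ≠ j) :
    T.coxeterMatrix i j = 2 ∨ T.coxeterMatrix i j = 3 ∨ T.coxeterMatrix i j = 4 := by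
  have h' : ¬(i : ℕ) = j := fun h' => h (Fin.ext h')
  cases T with
  | A => rw [coxeterMatrix_A_apply]; split_ifs <;> simp
  | B => rw [coxeterMatrix_B_apply]; split_ifs <;> simp
  | C => rw [coxeterMatrix_C_apply]; split_ifs <;> simp
  | DA => rw [coxeterMatrix_DA_apply]; split_ifs <;> simp
  | DD => rw [coxeterMatrix_DD_apply]; split_ifs <;> simp
  | E6 =>
    change Fin 6 at i j
    change CoxeterMatrix.E₆ i j = 2 ∨ CoxeterMatrix.E₆ i j = 3 ∨ CoxeterMatrix.E₆ i j = 4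
    clear h
    fin_cases i <;> fin_cases j <;> first | exact absurd rfl h' | simp [CoxeterMatrix.E₆]
  | E7 =>
    change Fin 7 at i j
    change CoxeterMatrix.E₇ i j = 2 ∨ CoxeterMatrix.E₇ i j = 3 ∨ CoxeterMatrix.E₇ i j = 4
    clear h
    fin_cases i <;> fin_cases j <;> first | exact absurd rfl h' | simp [CoxeterMatrix.E₇]

theorem cartan_of_two {T : HermitianType} {i j : Fin T.rank} (h : T.coxeterMatrix i j = 2) :
    T.cartan i j = 0 := by
  have : i ≠ j := by rintro rfl; simp at h
  simp [cartan, this, h]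

theorem cartan_of_three {T : HermitianType} {i j : Fin T.rank} (h : T.coxeterMatrix i j = 3) :
    T.cartan i j = -1 := by
  have : i ≠ j := by rintro rfl; simp at h
  simp [cartan, this, h]

theorem cartan_of_four {T : HermitianType} {i j : Fin T.rank} (h : T.coxeterMatrix i j = 4) :
    T.cartan i j = -1 ∧ T.cartan j i = -2 ∨ T.cartan i j = -2 ∧ T.cartan j i = -1 := by
  have hij : i ≠ j := by rintro rfl; simp at h
  have h' := T.coxeterMatrix.symmetric i j
  have h2 : (i : ℕ) ≠ j := fun h' => hij (Fin.ext h')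
  simp only [cartan, hij, hij.symm, h, ← h']
  cases T.lastLong <;> rcases lt_or_gt_of_ne h2 with h3 | h3 <;> simp [h3, h3.not_gt]

theorem cartan_nonpos {T : HermitianType} {i j : Fin T.rank} (h : i ≠ j) : T.cartan i j ≤ 0 := by
  rcases T.coxeterMatrix_mem h with h | h | h
  · rw [cartan_of_two h]
  · rw [cartan_of_three h]; simp
  · rcases cartan_of_four h with h | h <;> rw [h.1] <;> simp

theorem cartan_eq_zero_comm {T : HermitianType} {i j : Fin T.rank} :
    T.cartan i j = 0 ↔ T.cartan j i = 0 := by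
  have h' := T.coxeterMatrix.symmetric i j
  rcases eq_or_ne i j with rfl | h
  · rfl
  rcases T.coxeterMatrix_mem h with h | h | h
  · rw [cartan_of_two h, cartan_of_two (h' ▸ h)]
  · rw [cartan_of_three h, cartan_of_three (h' ▸ h)]
  · rcases cartan_of_four h with h | h <;> rw [h.1, h.2] <;> simp

/-! ### Addable and removable boxes -/

/-- `b` can be added to the subdiagram `M`. -/
def IsAddable (T : HermitianType) (M : Finset (ℕ × ℕ)) (b : ℕ × ℕ) : Prop :=
  b ∉ M ∧ T.IsSubdiagram (insert b M)

/-- `b` can be removed from the subdiagram `M`. -/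
def IsRemovable (T : HermitianType) (M : Finset (ℕ × ℕ)) (b : ℕ × ℕ) : Prop :=
  b ∈ M ∧ T.IsSubdiagram (M.erase b)

/-- A box labelled by `i` can be added to `M`. -/
def HasAddable (T : HermitianType) (M : Finset (ℕ × ℕ)) (i : Fin T.rank) : Prop :=
  ∃ r c, T.IsAddable M (r, c) ∧ T.label r c = i + 1

/-- A box labelled by `i` can be removed from `M`. -/
def HasRemovable (T : HermitianType) (M : Finset (ℕ × ℕ)) (i : Fin T.rank) : Prop :=
  ∃ r c, T.IsRemovable M (r, c) ∧ T.label r c = i + 1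

section Subdiagram

variable {T : HermitianType} {M : Finset (ℕ × ℕ)}

theorem IsSubdiagram.label_ne_zero (hM : T.IsSubdiagram M) {r c : ℕ} (h : (r, c) ∈ M) :
    T.label r c ≠ 0 := (T.mem_boxes _).1 (hM.1 _ h)

theorem IsSubdiagram.mem_of_le (hM : T.IsSubdiagram M) {r c r' c' : ℕ} (h : (r', c') ∈ M)
    (hb : T.label r c ≠ 0) (hr : r ≤ r') (hc : c ≤ c') : (r, c) ∈ M :=
  hM.2 _ h _ ((T.mem_boxes (r, c)).2 hb) hr hc

/-- By `exists_predecessor`, any box above and to the left of the new one lies above and to the left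
of one of its immediate neighbours, which already belongs to `M`. -/
theorem isAddable_iff (hM : T.IsSubdiagram M) {r c : ℕ} : T.IsAddable M (r, c) ↔
    T.label r c ≠ 0 ∧ (r, c) ∉ M ∧ (0 < c → T.label r (c - 1) ≠ 0 → (r, c - 1) ∈ M) ∧
      (0 < r → T.label (r - 1) c ≠ 0 → (r - 1, c) ∈ M) := by
  constructor
  · rintro ⟨h1, h2⟩
    refine ⟨h2.label_ne_zero (Finset.mem_insert_self _ _), h1, fun hc hb => ?_, fun hr hb => ?_⟩
    · have := h2.mem_of_le (Finset.mem_insert_self _ _) hb le_rfl (Nat.sub_le c 1)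
      refine (Finset.mem_insert.1 this).resolve_left fun h => ?_
      simp only [Prod.mk.injEq] at h
      omega
    · have := h2.mem_of_le (Finset.mem_insert_self _ _) hb (Nat.sub_le r 1) le_rfl
      refine (Finset.mem_insert.1 this).resolve_left fun h => ?_
      simp only [Prod.mk.injEq] at h
      omega
  · rintro ⟨h1, h2, h3, h4⟩
    refine ⟨h2, fun b hb => ?_, fun b hb x hx hr hc => ?_⟩
    · rcases Finset.mem_insert.1 hb with rfl | hb
      · exact (T.mem_boxes _).2 h1
      · exact hM.1 b hb
    · rw [Finset.mem_insert]
      rcases Finset.mem_insert.1 hb with rfl | hb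
      · obtain ⟨r', c'⟩ := x
        have hx := (T.mem_boxes _).1 hx
        by_cases hne : r' < r ∨ c' < c
        · right
          rcases exists_predecessor hx h1 hr hc hne with ⟨h5, h6⟩ | ⟨h5, h6⟩
          · exact hM.mem_of_le (h3 (by omega) h6) hx hr (by omega)
          · exact hM.mem_of_le (h4 (by omega) h6) hx (by omega) hc
        · left
          ext <;> dsimp only at * <;> omega
      · exact Or.inr (hM.2 b hb x hx hr hc)

/-- Walk back from `(r', c')` towards `(r, c)` by unit steps; the closure of `M` keeps the walk
inside `M`, and its last position before `(r, c)` is the required neighbour. -/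
theorem IsSubdiagram.exists_cover (hM : T.IsSubdiagram M) {r c r' c' : ℕ} (hb : T.label r c ≠ 0)
    (h : (r', c') ∈ M) (hr : r ≤ r') (hc : c ≤ c') (hne : r < r' ∨ c < c') :
    (r, c + 1) ∈ M ∨ (r + 1, c) ∈ M := by
  induction hs : r' + c' generalizing r' c' with
  | zero => omega
  | succ s ih =>
    rcases exists_predecessor hb (hM.label_ne_zero h) hr hc hne with ⟨h5, h6⟩ | ⟨h5, h6⟩
    · by_cases h7 : r < r' ∨ c < c' - 1
      · exact ih (hM.mem_of_le h h6 le_rfl (by omega)) hr (by omega) h7 (by omega)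
      · obtain rfl : r = r' := by omega
        obtain rfl : c' = c + 1 := by omega
        exact Or.inl h
    · by_cases h7 : r < r' - 1 ∨ c < c'
      · exact ih (hM.mem_of_le h h6 (by omega) le_rfl) (by omega) hc h7 (by omega)
      · obtain rfl : c = c' := by omega
        obtain rfl : r' = r + 1 := by omega
        exact Or.inr h

theorem isRemovable_iff (hM : T.IsSubdiagram M) {r c : ℕ} : T.IsRemovable M (r, c) ↔
    (r, c) ∈ M ∧ (r, c + 1) ∉ M ∧ (r + 1, c) ∉ M := by
  constructor
  · rintro ⟨h1, h2⟩
    have hb := hM.label_ne_zero h1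
    refine ⟨h1, fun h => ?_, fun h => ?_⟩
    · exact Finset.notMem_erase _ _ (h2.mem_of_le (Finset.mem_erase.2 ⟨by simp, h⟩) hb le_rfl
        (Nat.le_succ c))
    · exact Finset.notMem_erase _ _ (h2.mem_of_le (Finset.mem_erase.2 ⟨by simp, h⟩) hb
        (Nat.le_succ r) le_rfl)
  · rintro ⟨h1, h2, h3⟩
    refine ⟨h1, fun b hb => hM.1 b (Finset.mem_of_mem_erase hb), ?_⟩
    rintro ⟨r', c'⟩ hb x hx hr hc
    have hb' := Finset.mem_erase.1 hb
    refine Finset.mem_erase.2 ⟨?_, hM.2 _ hb'.2 x hx hr hc⟩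
    rintro rfl
    refine (hM.exists_cover (hM.label_ne_zero h1) hb'.2 hr hc ?_).elim h2 h3
    by_contra hne
    apply hb'.1
    ext <;> dsimp only at * <;> omega

theorem coxeterMatrix_eq_two {r c r' c' : ℕ} {i j : Fin T.rank} (hi : T.label r c = i + 1)
    (hj : T.label r' c' = j + 1) (h : ¬(r ≤ r' ∧ c ≤ c')) (h' : ¬(r' ≤ r ∧ c' ≤ c)) :
    T.coxeterMatrix i j = 2 := by
  rcases (by omega : r < r' ∧ c' < c ∨ r' < r ∧ c < c') with ⟨h1, h2⟩ | ⟨h1, h2⟩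
  · exact commute_of_incomparable h1 h2 hi hj
  · rw [T.coxeterMatrix.symmetric]
    exact commute_of_incomparable h1 h2 hj hi

/-- Incomparable boxes have labels with Coxeter entry `2`, whereas the diagonal entry is `1`. -/
theorem comparable_of_label_eq {r c r' c' : ℕ} {i : Fin T.rank} (hi : T.label r c = i + 1)
    (hj : T.label r' c' = i + 1) : (r ≤ r' ∧ c ≤ c') ∨ (r' ≤ r ∧ c' ≤ c) := by
  by_contra h
  rw [not_or] at h
  have := coxeterMatrix_eq_two hi hj h.1 h.2
  simp at this

theorem IsRemovable.eq_of_le (hM : T.IsSubdiagram M) {r c r' c' : ℕ} (h : T.IsRemovable M (r, c))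
    (h' : (r', c') ∈ M) (hr : r ≤ r') (hc : c ≤ c') : (r, c) = (r', c') := by
  by_contra hne
  exact Finset.notMem_erase _ _ (h.2.mem_of_le (Finset.mem_erase.2 ⟨fun h => hne h.symm, h'⟩)
    (hM.label_ne_zero h.1) hr hc)

theorem IsRemovable.coxeterMatrix_eq_two (hM : T.IsSubdiagram M) {r c r' c' : ℕ}
    (h : T.IsRemovable M (r, c)) (h' : T.IsRemovable M (r', c')) (hne : (r, c) ≠ (r', c'))
    {i j : Fin T.rank} (hi : T.label r c = i + 1) (hj : T.label r' c' = j + 1) :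
    T.coxeterMatrix i j = 2 :=
  HermitianType.coxeterMatrix_eq_two hi hj (fun hle => hne (h.eq_of_le hM h'.1 hle.1 hle.2))
    (fun hle => hne (h'.eq_of_le hM h.1 hle.1 hle.2).symm)

theorem IsAddable.not_le {r c r' c' : ℕ} (h : T.IsAddable M (r, c)) (h' : T.IsAddable M (r', c'))
    (hne : (r, c) ≠ (r', c')) : ¬(r ≤ r' ∧ c ≤ c') := by
  rintro ⟨hr, hc⟩
  have h1 := h'.2.mem_of_le (Finset.mem_insert_self _ _)
    (h.2.label_ne_zero (Finset.mem_insert_self _ _)) hr hc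
  exact (Finset.mem_insert.1 h1).elim hne h.1

theorem IsAddable.coxeterMatrix_eq_two {r c r' c' : ℕ}
    (h : T.IsAddable M (r, c)) (h' : T.IsAddable M (r', c')) (hne : (r, c) ≠ (r', c'))
    {i j : Fin T.rank} (hi : T.label r c = i + 1) (hj : T.label r' c' = j + 1) :
    T.coxeterMatrix i j = 2 :=
  HermitianType.coxeterMatrix_eq_two hi hj (h.not_le h' hne) (h'.not_le h hne.symm)

theorem IsAddable.isRemovable (hM : T.IsSubdiagram M) {b : ℕ × ℕ} (h : T.IsAddable M b) :
    T.IsRemovable (insert b M) b :=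
  ⟨Finset.mem_insert_self _ _, by rwa [Finset.erase_insert h.1]⟩

theorem IsRemovable.isAddable (hM : T.IsSubdiagram M) {b : ℕ × ℕ} (h : T.IsRemovable M b) :
    T.IsAddable (M.erase b) b :=
  ⟨Finset.notMem_erase _ _, by rwa [Finset.insert_erase h.1]⟩

theorem IsSubdiagram.exists_isRemovable (hM : T.IsSubdiagram M) (h : M.Nonempty) :
    ∃ r c, T.IsRemovable M (r, c) := by
  obtain ⟨⟨r, c⟩, h1, h2⟩ := M.exists_max_image (fun b => b.1 + b.2) h
  refine ⟨r, c, (isRemovable_iff hM).2 ⟨h1, fun h => ?_, fun h => ?_⟩⟩ <;>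
    · have := h2 _ h
      dsimp only at this
      omega

end Subdiagram

/-! ### The weight of a subdiagram -/

/-- The number of boxes of `M` labelled by `i`. -/
def count (T : HermitianType) (M : Finset (ℕ × ℕ)) (i : Fin T.rank) : ℤ :=
  ((M.filter fun b => T.label b.1 b.2 = i + 1).card : ℤ)

/-- The value at the simple coroot of `i` of the fundamental weight of `T.node` minus the sum of
the simple roots with multiplicities `a`. -/
def weight (T : HermitianType) (a : Fin T.rank → ℤ) (i : Fin T.rank) : ℤ :=
  (if i = T.index T.node then 1 else 0) - ∑ j, T.cartan i j * a j

variable {T : HermitianType} {M : Finset (ℕ × ℕ)}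

theorem count_insert {r c : ℕ} (h : (r, c) ∉ M) {j : Fin T.rank} (hj : T.label r c = j + 1) :
    T.count (insert (r, c) M) = T.count M + Pi.single j 1 := by
  ext i
  rw [count, Finset.filter_insert, Pi.add_apply, Pi.single_apply]
  by_cases hij : i = j
  · subst hij
    rw [if_pos hj, if_pos rfl, Finset.card_insert_of_notMem (by simp [h]), count]
    push_cast; rfl
  · rw [if_neg, if_neg hij, count, add_zero]
    dsimp only
    rw [hj]
    intro h'
    exact hij (Fin.ext (by omega))

theorem weight_add_single (a : Fin T.rank → ℤ) (i j : Fin T.rank) (x : ℤ) :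
    T.weight (a + Pi.single j x) i = T.weight a i - T.cartan i j * x := by
  simp only [weight, Pi.add_apply, mul_add, Finset.sum_add_distrib]
  rw [Finset.sum_eq_single (f := fun k => T.cartan i k * Pi.single (M := fun _ => ℤ) j x k) j
    (by intro k _ hk; simp [hk]) (by simp), Pi.single_eq_same]
  ring

theorem node_eq (T : HermitianType) : T.node = T.index T.node + 1 := by
  have : 1 ≤ T.node ∧ T.node ≤ T.rank := by
    cases T <;> simp only [node, rank] <;> omega
  simp only [index]
  rw [Nat.mod_eq_of_lt (by omega)]
  omega

theorem label_ne_of_succ_column {r c : ℕ} {i : Fin T.rank} (h : T.label r c = i + 1) :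
    T.label r (c + 1) ≠ i + 1 := fun h' => by
  have := eq_of_label_eq_of_row (by omega) (h.trans h'.symm)
  omega

theorem label_ne_of_succ_row {r c : ℕ} {i : Fin T.rank} (h : T.label r c = i + 1) :
    T.label (r + 1) c ≠ i + 1 := fun h' => by
  have := eq_of_label_eq_of_column (by omega) (h.trans h'.symm)
  omega

theorem isSubdiagram_empty (T : HermitianType) : T.IsSubdiagram ∅ := ⟨by simp, by simp⟩

theorem hasAddable_empty {i : Fin T.rank} : T.HasAddable ∅ i ↔ i = T.index T.node := by
  have h0 := T.label_zero_zero.trans T.node_eq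
  constructor
  · rintro ⟨r, c, h, hi⟩
    rw [isAddable_iff T.isSubdiagram_empty] at h
    obtain ⟨h1, -, h2, h3⟩ := h
    by_cases hne : 0 < r ∨ 0 < c
    · rcases exists_predecessor (by omega) h1 r.zero_le c.zero_le hne with ⟨h4, h5⟩ | ⟨h4, h5⟩
      · exact absurd (h2 h4 h5) (by simp)
      · exact absurd (h3 h4 h5) (by simp)
    · obtain ⟨rfl, rfl⟩ : r = 0 ∧ c = 0 := by omega
      exact Fin.ext (by omega)
  · rintro rfl
    exact ⟨0, 0, (isAddable_iff T.isSubdiagram_empty).2 (by simp [h0]), h0⟩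

/-- A new box can make addable only the boxes directly below it and directly to its right, and each
of these also needs its other predecessor, if that exists. The implications have the shape required
by `neighbour_count`. -/
theorem hasAddable_insert_iff (hM : T.IsSubdiagram M) {r c : ℕ} (hd : T.IsAddable M (r, c))
    {i j : Fin T.rank} (hj : T.label r c = j + 1) (hij : i ≠ j) :
    T.HasAddable (insert (r, c) M) i ↔ T.HasAddable M i ∨
      (T.label (r + 1) c = i + 1 ∧
        ((0 < c ∧ T.label (r + 1) (c - 1) ≠ 0) → 0 < c ∧ (r + 1, c - 1) ∈ M)) ∨
      (T.label r (c + 1) = i + 1 ∧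
        ((0 < r ∧ T.label (r - 1) (c + 1) ≠ 0) → 0 < r ∧ (r - 1, c + 1) ∈ M)) := by
  constructor
  · rintro ⟨r', c', h, hi⟩
    rw [isAddable_iff hd.2] at h
    obtain ⟨h1, h2, h3, h4⟩ := h
    simp only [Finset.mem_insert, Prod.mk.injEq, not_or] at h2 h3 h4
    by_cases h5 : r' = r ∧ c' = c + 1
    · obtain ⟨rfl, rfl⟩ := h5
      refine Or.inr (Or.inr ⟨hi, fun h6 => ⟨h6.1, (h4 h6.1 h6.2).resolve_left (by omega)⟩⟩)
    by_cases h6 : r' = r + 1 ∧ c' = c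
    · obtain ⟨rfl, rfl⟩ := h6
      refine Or.inr (Or.inl ⟨hi, fun h6 => ⟨h6.1, (h3 h6.1 h6.2).resolve_left (by omega)⟩⟩)
    refine Or.inl ⟨r', c', (isAddable_iff hM).2 ⟨h1, h2.2, fun h7 h8 => ?_, fun h7 h8 => ?_⟩, hi⟩
    · exact (h3 h7 h8).resolve_left (by omega)
    · exact (h4 h7 h8).resolve_left (by omega)
  · rw [isAddable_iff hM] at hd
    rintro (⟨r', c', h, hi⟩ | ⟨h1, h2⟩ | ⟨h1, h2⟩)
    · rw [isAddable_iff hM] at h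
      obtain ⟨h1, h2, h3, h4⟩ := h
      refine ⟨r', c', (isAddable_iff ((isAddable_iff hM).2 hd).2).2 ⟨h1, ?_,
        fun h5 h6 => Finset.mem_insert_of_mem (h3 h5 h6),
        fun h5 h6 => Finset.mem_insert_of_mem (h4 h5 h6)⟩, hi⟩
      rw [Finset.mem_insert, Prod.mk.injEq, not_or]
      refine ⟨?_, h2⟩
      rintro ⟨rfl, rfl⟩
      exact hij (Fin.ext (by omega))
    · refine ⟨r + 1, c, (isAddable_iff ((isAddable_iff hM).2 hd).2).2 ⟨by omega, ?_,
        fun h5 h6 => Finset.mem_insert_of_mem (h2 ⟨h5, h6⟩).2,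
        fun h5 h6 => Finset.mem_insert_self _ _⟩, h1⟩
      rw [Finset.mem_insert, Prod.mk.injEq, not_or]
      exact ⟨by omega, fun h => hd.2.1 (hM.mem_of_le h hd.1 (by omega) (by omega))⟩
    · refine ⟨r, c + 1, (isAddable_iff ((isAddable_iff hM).2 hd).2).2 ⟨by omega, ?_,
        fun h5 h6 => Finset.mem_insert_self _ _,
        fun h5 h6 => Finset.mem_insert_of_mem (h2 ⟨h5, h6⟩).2⟩, h1⟩
      rw [Finset.mem_insert, Prod.mk.injEq, not_or]
      exact ⟨by omega, fun h => hd.2.1 (hM.mem_of_le h hd.1 (by omega) (by omega))⟩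

/-- Dually, a new box can block only its left and upper neighbours, and only those not already
blocked by another box of `M`. -/
theorem hasRemovable_iff_insert (hM : T.IsSubdiagram M) {r c : ℕ} (hd : T.IsAddable M (r, c))
    {i j : Fin T.rank} (hj : T.label r c = j + 1) (hij : i ≠ j) :
    T.HasRemovable M i ↔ T.HasRemovable (insert (r, c) M) i ∨
      ((0 < c ∧ T.label r (c - 1) = i + 1) ∧ ¬(0 < c ∧ (r + 1, c - 1) ∈ M)) ∨
      ((0 < r ∧ T.label (r - 1) c = i + 1) ∧ ¬(0 < r ∧ (r - 1, c + 1) ∈ M)) := by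
  constructor
  · rintro ⟨r', c', h, hi⟩
    obtain ⟨h1, h2, h3⟩ := (isRemovable_iff hM).1 h
    by_cases h5 : r' = r ∧ c' + 1 = c
    · obtain ⟨rfl, rfl⟩ := h5
      exact Or.inr (Or.inl ⟨⟨by omega, hi⟩, fun h => h3 h.2⟩)
    by_cases h6 : r' + 1 = r ∧ c' = c
    · obtain ⟨rfl, rfl⟩ := h6
      exact Or.inr (Or.inr ⟨⟨by omega, hi⟩, fun h => h2 h.2⟩)
    refine Or.inl ⟨r', c', (isRemovable_iff hd.2).2 ⟨Finset.mem_insert_of_mem h1, ?_, ?_⟩, hi⟩ <;>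
      simp only [Finset.mem_insert, Prod.mk.injEq, not_or]
    · exact ⟨by omega, h2⟩
    · exact ⟨by omega, h3⟩
  · have hd' := (isAddable_iff hM).1 hd
    rintro (⟨r', c', h, hi⟩ | ⟨⟨h0, h1⟩, h2⟩ | ⟨⟨h0, h1⟩, h2⟩)
    · rw [isRemovable_iff hd.2] at h
      simp only [Finset.mem_insert, Prod.mk.injEq, not_or] at h
      obtain ⟨h1, ⟨-, h2⟩, -, h3⟩ := h
      refine ⟨r', c', (isRemovable_iff hM).2 ⟨h1.resolve_left ?_, h2, h3⟩, hi⟩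
      rintro ⟨rfl, rfl⟩
      exact hij (Fin.ext (by omega))
    · refine ⟨r, c - 1, (isRemovable_iff hM).2 ⟨hd'.2.2.1 h0 (by omega), ?_, fun h => h2 ⟨h0, h⟩⟩, h1⟩
      rw [Nat.sub_add_cancel h0]
      exact hd'.2.1
    · refine ⟨r - 1, c, (isRemovable_iff hM).2 ⟨hd'.2.2.2 h0 (by omega), fun h => h2 ⟨h0, h⟩, ?_⟩, h1⟩
      rw [Nat.sub_add_cancel h0]
      exact hd'.2.1

/-- Boxes with equal labels are comparable, so an addable box labelled `i` would lie beyond the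
removable one. Its predecessor in `M` would then be the removable box itself, but adjacent boxes
have different labels. -/
theorem not_hasAddable_of_isRemovable (hM : T.IsSubdiagram M) {r c : ℕ} {i : Fin T.rank}
    (hd : T.IsRemovable M (r, c)) (hi : T.label r c = i + 1) : ¬ T.HasAddable M i := by
  rintro ⟨r', c', h, hi'⟩
  obtain ⟨h1, h2, h3, h4⟩ := (isAddable_iff hM).1 h
  have h0 := hM.label_ne_zero hd.1
  rcases comparable_of_label_eq hi' hi with ⟨hr, hc⟩ | ⟨hr, hc⟩
  · exact h2 (hM.mem_of_le hd.1 h1 hr hc)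
  by_cases hne : r < r' ∨ c < c'
  · rcases exists_predecessor h0 h1 hr hc hne with ⟨h5, h6⟩ | ⟨h5, h6⟩
    · have h7 := hd.eq_of_le hM (h3 (by omega) h6) hr (by omega)
      simp only [Prod.mk.injEq] at h7
      obtain ⟨rfl, rfl⟩ := h7
      exact label_ne_of_succ_column hi (by rwa [Nat.sub_add_cancel (by omega)])
    · have h7 := hd.eq_of_le hM (h4 (by omega) h6) (by omega) hc
      simp only [Prod.mk.injEq] at h7
      obtain ⟨rfl, rfl⟩ := h7
      exact label_ne_of_succ_row hi (by rwa [Nat.sub_add_cancel (by omega)])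
  · obtain ⟨rfl, rfl⟩ : r' = r ∧ c' = c := by omega
    exact h2 hd.1

theorem not_hasRemovable_of_isAddable (hM : T.IsSubdiagram M) {r c : ℕ} {i : Fin T.rank}
    (hd : T.IsAddable M (r, c)) (hi : T.label r c = i + 1) : ¬ T.HasRemovable M i := by
  rintro ⟨r', c', h, hi'⟩
  exact not_hasAddable_of_isRemovable hM h hi' ⟨r, c, hd, hi⟩

/-- Here `l`, `u`, `d`, `e` say that the left, upper, lower, right neighbour of the new box is
labelled `i`; `f`, `g` that the lower left and upper right diagonal boxes exist; `m`, `n` that they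
lie in `M`. The left side is the neighbour count for minus the Cartan integer, the right side counts
the newly blocked and newly addable boxes. -/
theorem neighbour_count {l u d e f g m n : Prop} [Decidable l] [Decidable u] [Decidable d]
    [Decidable e] [Decidable f] [Decidable g] [Decidable m] [Decidable n]
    (hf : f → (l ↔ d)) (hg : g → (u ↔ e)) (hm : m → f) (hn : n → g)
    (h1 : ¬((l ∧ ¬m) ∧ (u ∧ ¬n))) (h2 : ¬((d ∧ (f → m)) ∧ (e ∧ (g → n)))) :
    (if l then 1 else 0) + (if u then 1 else 0) + (if d ∧ ¬f then 1 else 0) +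
      (if e ∧ ¬g then (1 : ℤ) else 0) =
    (if (l ∧ ¬m) ∨ (u ∧ ¬n) then 1 else 0) +
      (if (d ∧ (f → m)) ∨ (e ∧ (g → n)) then (1 : ℤ) else 0) := by
  by_cases f <;> by_cases g <;> by_cases m <;> by_cases n <;> by_cases l <;> by_cases u <;>
    by_cases d <;> by_cases e <;> simp_all

open Classical in
-- The difference of the two indicators changes exactly as the value at `i` of a weight from which
-- `α_j` is subtracted; this is the inductive step of `weight_count`.
theorem weight_count_insert (hM : T.IsSubdiagram M) {r c : ℕ} (hd : T.IsAddable M (r, c))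
    {i j : Fin T.rank} (hj : T.label r c = j + 1) :
    (if T.HasAddable (insert (r, c) M) i then 1 else 0) -
      (if T.HasRemovable (insert (r, c) M) i then (1 : ℤ) else 0) =
    (if T.HasAddable M i then 1 else 0) - (if T.HasRemovable M i then 1 else 0) -
      T.cartan i j := by
  have hr := hd.isRemovable hM
  have hM' := hd.2
  rcases eq_or_ne i j with rfl | hij
  · rw [if_neg (not_hasAddable_of_isRemovable hM' hr hj), if_pos ⟨r, c, hr, hj⟩,
      if_pos ⟨r, c, hd, hj⟩, if_neg (not_hasRemovable_of_isAddable hM hd hj), cartan_self]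
    rfl
  obtain ⟨h1, h2, h3⟩ := cartan_eq_neg_neighbours hj hij
  have hd' := (isAddable_iff hM).1 hd
  have hA := hasAddable_insert_iff hM hd hj hij
  have hR := hasRemovable_iff_insert hM hd hj hij
  have key := neighbour_count (m := 0 < c ∧ (r + 1, c - 1) ∈ M) (n := 0 < r ∧ (r - 1, c + 1) ∈ M)
    h1 h2 (fun h => ⟨h.1, hM.label_ne_zero h.2⟩) (fun h => ⟨h.1, hM.label_ne_zero h.2⟩) ?_ ?_
  rotate_left
  -- Two distinct removable boxes have commuting labels, so they cannot both be labelled `i`; the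
  -- next case is the same argument for addable boxes.
  · rintro ⟨⟨⟨h4, h5⟩, h6⟩, ⟨⟨h7, h8⟩, h9⟩⟩
    have e1 : T.IsRemovable M (r, c - 1) := (isRemovable_iff hM).2
      ⟨hd'.2.2.1 h4 (by omega), by rw [Nat.sub_add_cancel h4]; exact hd'.2.1, fun h => h6 ⟨h4, h⟩⟩
    have e2 : T.IsRemovable M (r - 1, c) := (isRemovable_iff hM).2
      ⟨hd'.2.2.2 h7 (by omega), fun h => h9 ⟨h7, h⟩, by rw [Nat.sub_add_cancel h7]; exact hd'.2.1⟩
    have := e1.coxeterMatrix_eq_two hM e2 (by simp only [ne_eq, Prod.mk.injEq]; omega) h5 h8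
    simp at this
  · rintro ⟨⟨h4, h5⟩, h6, h7⟩
    have e1 : T.IsAddable (insert (r, c) M) (r + 1, c) := (isAddable_iff hM').2 ⟨by omega,
      fun h => by
        rw [Finset.mem_insert, Prod.mk.injEq] at h
        exact hd'.2.1 (hM.mem_of_le (h.resolve_left (by omega)) hd'.1 (by omega) (by omega)),
      fun h8 h9 => Finset.mem_insert_of_mem (h5 ⟨h8, h9⟩).2,
      fun h8 h9 => Finset.mem_insert_self _ _⟩
    have e2 : T.IsAddable (insert (r, c) M) (r, c + 1) := (isAddable_iff hM').2 ⟨by omega,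
      fun h => by
        rw [Finset.mem_insert, Prod.mk.injEq] at h
        exact hd'.2.1 (hM.mem_of_le (h.resolve_left (by omega)) hd'.1 (by omega) (by omega)),
      fun h8 h9 => Finset.mem_insert_self _ _,
      fun h8 h9 => Finset.mem_insert_of_mem (h7 ⟨h8, h9⟩).2⟩
    have := e1.coxeterMatrix_eq_two e2 (by simp) h4 h6
    simp at this
  rw [key] at h3
  -- If `i` and `j` commute, the neighbour count is zero and nothing changes. Otherwise no box
  -- labelled `i` is addable to `M` or removable after the insertion, because such a box would have
  -- to commute with the one labelled `j`; only the newly affected boxes remain.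
  by_cases h0 : T.coxeterMatrix i j = 2
  · rw [cartan_of_two h0] at h3 ⊢
    simp only [hA, hR]
    split_ifs at h3 with h4 h5 h6
    · simp at h3
    · simp at h3
    · simp at h3
    · simp only [h4, h6, or_false, sub_zero]
  · have hA0 : ¬ T.HasAddable M i := by
      rintro ⟨r', c', h, hi⟩
      refine h0 (h.coxeterMatrix_eq_two hd (fun h => hij (Fin.ext ?_)) hi hj)
      simp only [Prod.mk.injEq] at h
      obtain ⟨rfl, rfl⟩ := h
      omega
    have hR0 : ¬ T.HasRemovable (insert (r, c) M) i := by
      rintro ⟨r', c', h, hi⟩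
      refine h0 (h.coxeterMatrix_eq_two hM' hr (fun h => hij (Fin.ext ?_)) hi hj)
      simp only [Prod.mk.injEq] at h
      obtain ⟨rfl, rfl⟩ := h
      omega
    rw [or_iff_right hA0] at hA
    rw [or_iff_right hR0] at hR
    rw [if_neg hA0, if_neg hR0, h3]
    simp only [hA, hR]
    ring

open Classical in
-- This is the minuscule property: all values lie in `{-1, 0, 1}`, and the diagram tells which one
-- occurs.
theorem weight_count (hM : T.IsSubdiagram M) (i : Fin T.rank) :
    T.weight (T.count M) i =
      (if T.HasAddable M i then 1 else 0) - (if T.HasRemovable M i then 1 else 0) := by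
  induction hn : M.card generalizing M with
  | zero =>
    obtain rfl := Finset.card_eq_zero.1 hn
    have h0 : T.count ∅ = 0 := by ext i; simp [count]
    rw [if_neg (c := T.HasRemovable ∅ i) (by rintro ⟨r, c, h, -⟩; exact absurd h.1 (by simp)), h0]
    simp only [weight, Pi.zero_apply, mul_zero, Finset.sum_const_zero, hasAddable_empty]
  | succ n ih =>
    obtain ⟨r, c, h⟩ := hM.exists_isRemovable (Finset.card_pos.1 (by omega))
    have ha := h.isAddable hM
    obtain ⟨j, hj⟩ := exists_label_eq (hM.label_ne_zero h.1)
    have := weight_count_insert h.2 ha (i := i) hj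
    have hw := weight_add_single (T.count (M.erase (r, c))) i j 1
    rw [← count_insert ha.1 hj, ih h.2 (by rw [Finset.card_erase_of_mem h.1]; omega)] at hw
    rw [Finset.insert_erase h.1] at hw this
    rw [hw, this, mul_one]

theorem weight_eq_one (hM : T.IsSubdiagram M) {i : Fin T.rank} (h : T.HasAddable M i) :
    T.weight (T.count M) i = 1 := by
  classical
  rw [weight_count hM, if_pos h, if_neg, sub_zero]
  obtain ⟨r, c, h, hi⟩ := h
  exact not_hasRemovable_of_isAddable hM h hi

theorem weight_eq_neg_one (hM : T.IsSubdiagram M) {i : Fin T.rank} (h : T.HasRemovable M i) :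
    T.weight (T.count M) i = -1 := by
  classical
  rw [weight_count hM, if_pos h, if_neg, zero_sub]
  obtain ⟨r, c, h, hi⟩ := h
  exact not_hasAddable_of_isRemovable hM h hi

theorem weight_trichotomy (hM : T.IsSubdiagram M) (i : Fin T.rank) :
    (T.weight (T.count M) i = 1 ∧ T.HasAddable M i) ∨
      (T.weight (T.count M) i = -1 ∧ T.HasRemovable M i) ∨
      (T.weight (T.count M) i = 0) := by
  classical
  by_cases h1 : T.HasAddable M i
  · exact Or.inl ⟨weight_eq_one hM h1, h1⟩
  by_cases h2 : T.HasRemovable M i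
  · exact Or.inr (Or.inl ⟨weight_eq_neg_one hM h2, h2⟩)
  · exact Or.inr (Or.inr (by rw [weight_count hM, if_neg h1, if_neg h2, sub_zero]))

/-! ### The action on weights and the elements with a given diagram -/

theorem count_empty (T : HermitianType) : T.count ∅ = 0 := by ext i; simp [count]

theorem weight_add_smul (a : Fin T.rank → ℤ) (i j : Fin T.rank) (x : ℤ) :
    T.weight (a + x • Pi.single j 1) i = T.weight a i - T.cartan i j * x := by
  rw [← weight_add_single, ← Pi.single_smul, smul_eq_mul, mul_one]

/-- The affine action of a simple reflection on the weights of `T.node`, in terms of the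
multiplicities of the simple roots subtracted from the highest weight. -/
def simpleAction (T : HermitianType) (i : Fin T.rank) : Function.End (Fin T.rank → ℤ) :=
  fun a => a + T.weight a i • Pi.single i 1

theorem simpleAction_apply (i : Fin T.rank) (a : Fin T.rank → ℤ) :
    T.simpleAction i a = a + T.weight a i • Pi.single i 1 := rfl

/-- Each braid relation is an identity involving only two coordinates of the weight, so it depends
only on the pair of Cartan integers, which is `(0, 0)`, `(-1, -1)` or `(-1, -2)` up to order. -/
theorem isLiftable_simpleAction (T : HermitianType) :
    T.coxeterMatrix.IsLiftable T.simpleAction := by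
  intro i j
  have key : ∀ f g : Function.End (Fin T.rank → ℤ), ∀ a, (f * g) a = f (g a) := fun _ _ _ => rfl
  rcases eq_or_ne i j with rfl | hij
  · rw [T.coxeterMatrix.diagonal, pow_one]
    refine funext fun a => ?_
    simp only [key, simpleAction_apply, weight_add_smul, cartan_self]
    change _ = a
    module
  have hs := T.coxeterMatrix.symmetric i j
  rcases T.coxeterMatrix_mem hij with h | h | h
  · rw [h]
    refine funext fun a => ?_
    simp only [pow_succ, pow_zero, one_mul, key, simpleAction_apply, weight_add_smul, cartan_self,
      cartan_of_two h, cartan_of_two (hs ▸ h)]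
    change _ = a
    module
  · rw [h]
    refine funext fun a => ?_
    simp only [pow_succ, pow_zero, one_mul, key, simpleAction_apply, weight_add_smul, cartan_self,
      cartan_of_three h, cartan_of_three (hs ▸ h)]
    change _ = a
    module
  · rw [h]
    refine funext fun a => ?_
    rcases cartan_of_four h with ⟨h1, h2⟩ | ⟨h1, h2⟩ <;>
    · simp only [pow_succ, pow_zero, one_mul, key, simpleAction_apply, weight_add_smul,
        cartan_self, h1, h2]
      change _ = a
      module

theorem index_eq {k : ℕ} {i : Fin T.rank} (h : k = i + 1) : T.index k = i := by
  subst h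
  exact Fin.ext (by simp [index, Nat.mod_eq_of_lt i.isLt])

theorem sum_count (hM : T.IsSubdiagram M) : ∑ i, T.count M i = M.card := by
  simp only [count]
  rw [← Nat.cast_sum, Nat.cast_inj, Finset.card_eq_sum_card_fiberwise
    (f := fun b => T.index (T.label b.1 b.2)) (t := Finset.univ) (by simp)]
  refine Finset.sum_congr rfl fun i _ => congrArg Finset.card (Finset.filter_congr ?_)
  rintro ⟨r, c⟩ hb
  obtain ⟨j, hj⟩ := exists_label_eq (hM.label_ne_zero hb)
  dsimp only
  rw [index_eq hj, hj, Fin.ext_iff]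
  omega

/-- Boxes with a given label form a chain and a subdiagram contains an initial segment of it. Hence
a subdiagram is determined by its counts, and inclusion can be tested on them. -/
theorem subset_of_count_le {L : Finset (ℕ × ℕ)} (hM : T.IsSubdiagram M) (hL : T.IsSubdiagram L)
    (h : T.count M ≤ T.count L) : M ⊆ L := by
  rintro ⟨r, c⟩ hx
  by_contra hx'
  obtain ⟨i, hi⟩ := exists_label_eq (hM.label_ne_zero hx)
  have h1 := h i
  simp only [count, Nat.cast_le] at h1
  refine absurd h1 (not_le.2 (Finset.card_lt_card ?_))
  rw [Finset.ssubset_iff_of_subset]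
  · exact ⟨(r, c), Finset.mem_filter.2 ⟨hx, hi⟩, fun h => hx' (Finset.mem_filter.1 h).1⟩
  · rintro ⟨r', c'⟩ hy
    obtain ⟨hy1, hy2⟩ := Finset.mem_filter.1 hy
    refine Finset.mem_filter.2 ⟨?_, hy2⟩
    rcases comparable_of_label_eq hi hy2 with ⟨hr, hc⟩ | ⟨hr, hc⟩
    · exact absurd (hL.mem_of_le hy1 (by omega) hr hc) hx'
    · exact hM.mem_of_le hx (hL.label_ne_zero hy1) hr hc

theorem pairwise_boxes (T : HermitianType) :
    T.boxes.Pairwise fun a b => a.1 < b.1 ∨ a.1 = b.1 ∧ a.2 < b.2 := by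
  refine List.Pairwise.filter _ ?_
  change (List.product _ _).Pairwise _
  rw [List.product, List.pairwise_flatMap]
  refine ⟨fun r _ => ?_, ?_⟩
  · rw [List.pairwise_map]
    exact List.pairwise_lt_range.imp fun h => Or.inr ⟨rfl, h⟩
  · refine List.pairwise_lt_range.imp fun h x hx y hy => Or.inl ?_
    obtain ⟨_, -, rfl⟩ := List.mem_map.1 hx
    obtain ⟨_, -, rfl⟩ := List.mem_map.1 hy
    exact h

/-! ### Lengths and left descents of the elements with a diagram -/

section Group

variable {W : Type*} [Group W] (cs : CoxeterSystem T.coxeterMatrix W)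

/-- The element with diagram `M`. -/
def element (M : Finset (ℕ × ℕ)) : W := (cs.wordProd (T.readingWord M))⁻¹

theorem simple_commute {i j : Fin T.rank} (h : T.coxeterMatrix i j = 2) :
    cs.simple i * cs.simple j = cs.simple j * cs.simple i := by
  have := cs.wordProd_braidWord_eq i j
  simpa [CoxeterSystem.braidWord, CoxeterSystem.alternatingWord, ← T.coxeterMatrix.symmetric i j, h,
    CoxeterSystem.wordProd] using this

theorem simple_braid_three {i j : Fin T.rank} (h : T.coxeterMatrix i j = 3) :
    cs.simple i * (cs.simple j * cs.simple i) = cs.simple j * (cs.simple i * cs.simple j) := by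
  have := cs.wordProd_braidWord_eq i j
  simpa [CoxeterSystem.braidWord, CoxeterSystem.alternatingWord, ← T.coxeterMatrix.symmetric i j, h,
    CoxeterSystem.wordProd] using this.symm

theorem simple_braid_four {i j : Fin T.rank} (h : T.coxeterMatrix i j = 4) :
    cs.simple i * (cs.simple j * (cs.simple i * cs.simple j)) =
      cs.simple j * (cs.simple i * (cs.simple j * cs.simple i)) := by
  have := cs.wordProd_braidWord_eq i j
  simpa [CoxeterSystem.braidWord, CoxeterSystem.alternatingWord, ← T.coxeterMatrix.symmetric i j, h,
    CoxeterSystem.wordProd] using this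

theorem wordProd_mul_simple {l : List (Fin T.rank)} {i : Fin T.rank}
    (h : ∀ j ∈ l, T.coxeterMatrix j i = 2) :
    cs.wordProd l * cs.simple i = cs.simple i * cs.wordProd l := by
  induction l with
  | nil => simp
  | cons j l ih =>
    rw [cs.wordProd_cons, mul_assoc, ih fun k hk => h k (List.mem_cons_of_mem _ hk), ← mul_assoc,
      simple_commute cs (h j List.mem_cons_self), mul_assoc]

/-- The boxes of `M` read after a removable box are incomparable to it, so its letter commutes to
the end of the reading word, which is the left end of the inverse. -/
theorem element_eq_simple_mul (hM : T.IsSubdiagram M) {r c : ℕ} (h : T.IsRemovable M (r, c))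
    {i : Fin T.rank} (hi : T.label r c = i + 1) :
    element cs M = cs.simple i * element cs (M.erase (r, c)) := by
  obtain ⟨l₁, l₂, hl⟩ := List.append_of_mem (hM.1 _ h.1)
  have hp := T.pairwise_boxes
  rw [hl, List.pairwise_append, List.pairwise_cons] at hp
  obtain ⟨-, ⟨hp2, -⟩, hp1⟩ := hp
  have e1 : ∀ b ∈ l₁, b ≠ (r, c) := by
    rintro b hb rfl
    have := hp1 _ hb _ List.mem_cons_self
    omega
  have e2 : ∀ b ∈ l₂, b ≠ (r, c) := by
    rintro b hb rfl
    have := hp2 _ hb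
    omega
  have f1 : (l₁.filter fun b => b ∈ M.erase (r, c)) = l₁.filter fun b => b ∈ M :=
    List.filter_congr fun b hb => by simp [e1 b hb]
  have f2 : (l₂.filter fun b => b ∈ M.erase (r, c)) = l₂.filter fun b => b ∈ M :=
    List.filter_congr fun b hb => by simp [e2 b hb]
  have key : cs.wordProd (T.readingWord M) =
      cs.wordProd (T.readingWord (M.erase (r, c))) * cs.simple i := by
    simp only [readingWord, hl, List.filter_append, List.filter_cons, List.map_append, h.1,
      Finset.notMem_erase, decide_true, decide_false, if_true, f1, f2, List.map_cons,
      index_eq hi, cs.wordProd_append, cs.wordProd_cons, mul_assoc, Bool.false_eq_true, if_false]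
    rw [wordProd_mul_simple]
    intro j hj
    obtain ⟨⟨r', c'⟩, hb, rfl⟩ := List.mem_map.1 hj
    obtain ⟨hb1, hb2⟩ := List.mem_filter.1 hb
    have hb2 : (r', c') ∈ M := by simpa using hb2
    obtain ⟨k, hk⟩ := exists_label_eq (hM.label_ne_zero hb2)
    rw [index_eq hk]
    refine coxeterMatrix_eq_two hk hi (fun hle => ?_)
      (fun hle => e2 _ hb1 (h.eq_of_le hM hb2 hle.1 hle.2).symm)
    have := hp2 _ hb1
    dsimp only at this
    omega
  rw [element, key, mul_inv_rev, cs.inv_simple, element]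

theorem exists_removed (hM : T.IsSubdiagram M) {i : Fin T.rank}
    (h : T.weight (T.count M) i = -1) : ∃ N, T.IsSubdiagram N ∧
      T.count M = T.count N + Pi.single i 1 ∧ M.card = N.card + 1 ∧
      element cs M = cs.simple i * element cs N := by
  rcases weight_trichotomy hM i with h1 | ⟨-, r, c, h1, hi⟩ | h1
  · omega
  · refine ⟨M.erase (r, c), h1.2, ?_, (Finset.card_erase_add_one h1.1).symm,
      element_eq_simple_mul cs hM h1 hi⟩
    rw [← count_insert (Finset.notMem_erase _ _) hi, Finset.insert_erase h1.1]
  · omega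

theorem exists_added (hM : T.IsSubdiagram M) {i : Fin T.rank}
    (h : T.weight (T.count M) i = 1) : ∃ N, T.IsSubdiagram N ∧
      T.count N = T.count M + Pi.single i 1 ∧ N.card = M.card + 1 ∧
      element cs N = cs.simple i * element cs M := by
  rcases weight_trichotomy hM i with ⟨-, r, c, h1, hi⟩ | h1 | h1
  · refine ⟨insert (r, c) M, h1.2, count_insert h1.1 hi, Finset.card_insert_of_notMem h1.1, ?_⟩
    rw [element_eq_simple_mul cs h1.2 (h1.isRemovable hM) hi, Finset.erase_insert h1.1]
  · omega
  · omega

theorem exists_weight_eq_neg_one (hM : T.IsSubdiagram M) (h : M.Nonempty) :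
    ∃ i, T.weight (T.count M) i = -1 := by
  obtain ⟨r, c, h1⟩ := hM.exists_isRemovable h
  obtain ⟨i, hi⟩ := exists_label_eq (hM.label_ne_zero h1.1)
  exact ⟨i, weight_eq_neg_one hM ⟨r, c, h1, hi⟩⟩

theorem element_empty : element cs ∅ = 1 := by
  simp [element, readingWord]

theorem lift_element (hM : T.IsSubdiagram M) :
    cs.lift ⟨T.simpleAction, T.isLiftable_simpleAction⟩ (element cs M) 0 = T.count M := by
  induction hn : M.card generalizing M with
  | zero =>
    obtain rfl := Finset.card_eq_zero.1 hn
    rw [element_empty, map_one, count_empty]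
    rfl
  | succ n ih =>
    obtain ⟨i, hi⟩ := exists_weight_eq_neg_one hM (Finset.card_pos.1 (by omega))
    obtain ⟨N, h1, h2, h3, h4⟩ := exists_removed cs hM hi
    rw [h4, map_mul, cs.lift_apply_simple]
    change T.simpleAction i
      (cs.lift ⟨T.simpleAction, T.isLiftable_simpleAction⟩ (element cs N) 0) = _
    rw [ih h1 (by omega), simpleAction_apply]
    rw [h2, weight_add_single, cartan_self] at hi
    rw [h2, (by omega : T.weight (T.count N) i = 1), one_smul]

/-- Each letter adds a box, removes a box or fixes the weight. Thus a word of length `k` reaches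
only diagrams with at most `k` boxes, which bounds lengths from below. -/
theorem exists_lift_wordProd (ω : List (Fin T.rank)) : ∃ N, T.IsSubdiagram N ∧
    cs.lift ⟨T.simpleAction, T.isLiftable_simpleAction⟩ (cs.wordProd ω) 0 = T.count N ∧
    N.card ≤ ω.length := by
  induction ω with
  | nil =>
    exact ⟨∅, T.isSubdiagram_empty, by rw [cs.wordProd_nil, map_one, count_empty]; rfl, le_rfl⟩
  | cons i ω ih =>
    obtain ⟨N, h1, h2, h3⟩ := ih
    have h4 : cs.lift ⟨T.simpleAction, T.isLiftable_simpleAction⟩ (cs.wordProd (i :: ω)) 0 =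
        T.count N + T.weight (T.count N) i • Pi.single i 1 := by
      rw [cs.wordProd_cons, map_mul, cs.lift_apply_simple, ← h2]
      rfl
    rw [List.length_cons]
    rcases weight_trichotomy h1 i with ⟨h5, -⟩ | ⟨h5, -⟩ | h5
    · obtain ⟨N', h6, h7, h8, -⟩ := exists_added cs h1 h5
      exact ⟨N', h6, by rw [h4, h5, h7, one_smul], by omega⟩
    · obtain ⟨N', h6, h7, h8, -⟩ := exists_removed cs h1 h5
      exact ⟨N', h6, by rw [h4, h5, h7]; module, by omega⟩
    · exact ⟨N, h1, by rw [h4, h5, zero_smul, add_zero], by omega⟩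

theorem card_le_length (hM : T.IsSubdiagram M) {w : W}
    (h : cs.lift ⟨T.simpleAction, T.isLiftable_simpleAction⟩ w 0 = T.count M) :
    M.card ≤ cs.length w := by
  obtain ⟨ω, h1, rfl⟩ := cs.exists_isReduced w
  obtain ⟨N, h3, h4, h5⟩ := exists_lift_wordProd cs ω
  have h6 := sum_count hM
  rw [← h, h4, sum_count h3] at h6
  rw [h1.eq]
  omega

theorem length_element (hM : T.IsSubdiagram M) : cs.length (element cs M) = M.card := by
  apply le_antisymm
  · induction hn : M.card generalizing M with
    | zero =>
      obtain rfl := Finset.card_eq_zero.1 hn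
      simp [element_empty]
    | succ n ih =>
      obtain ⟨i, hi⟩ := exists_weight_eq_neg_one hM (Finset.card_pos.1 (by omega))
      obtain ⟨N, h1, h2, h3, h4⟩ := exists_removed cs hM hi
      have := cs.length_simple_mul (element cs N) i
      have := ih h1 (by omega)
      rw [h4]
      omega
  · exact card_le_length cs hM (lift_element cs hM)

theorem isLeftDescent_element_iff (hM : T.IsSubdiagram M) {i : Fin T.rank} :
    cs.IsLeftDescent (element cs M) i ↔ T.weight (T.count M) i = -1 := by
  constructor
  · intro h
    rw [CoxeterSystem.IsLeftDescent, length_element cs hM] at h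
    rcases weight_trichotomy hM i with ⟨h1, -⟩ | ⟨h1, -⟩ | h1
    · obtain ⟨N, h2, -, h3, h4⟩ := exists_added cs hM h1
      rw [← h4, length_element cs h2] at h
      omega
    · exact h1
    -- If the value is `0`, then `s_i` fixes the weight, so the product still leads to `M` and its
    -- length is at least `M.card`.
    · refine absurd (card_le_length cs hM ?_) (not_le.2 h)
      rw [map_mul, cs.lift_apply_simple]
      change T.simpleAction i
        (cs.lift ⟨T.simpleAction, T.isLiftable_simpleAction⟩ (element cs M) 0) = _
      rw [lift_element cs hM, simpleAction_apply, h1, zero_smul, add_zero]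
  · intro h
    obtain ⟨N, h2, -, h3, h4⟩ := exists_removed cs hM h
    rw [CoxeterSystem.IsLeftDescent, h4, cs.simple_mul_simple_cancel_left, ← h4,
      length_element cs hM, length_element cs h2]
    omega

/-- If the weight vanishes at `i`, then the reflection `s_i` moves through to the right. -/
theorem exists_simple_mul_element_eq (hM : T.IsSubdiagram M) {i : Fin T.rank}
    (h : T.weight (T.count M) i = 0) :
    ∃ j ∈ T.J, cs.simple i * element cs M = element cs M * cs.simple j := by
  induction hn : M.card using Nat.strong_induction_on generalizing M i with
  | _ n ih =>
    subst hn
    rcases M.eq_empty_or_nonempty with rfl | hne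
    -- For the empty diagram the value at `T.node` is `1`, so a zero value puts `i` in `J`.
    · refine ⟨i, fun hi => ?_, by simp [element_empty]⟩
      simp [count_empty, weight, hi] at h
    obtain ⟨l, hl⟩ := exists_weight_eq_neg_one hM hne
    obtain ⟨N, h1, h2, h3, h4⟩ := exists_removed cs hM hl
    have hil : i ≠ l := by rintro rfl; omega
    rw [h2, weight_add_single] at h hl
    rw [cartan_self] at hl
    have hs := T.coxeterMatrix.symmetric i l
    -- The value of `N` at `i` is `cartan i l`. For a bond `3`, a box labelled `i` can be removed
    -- from `N`, leaving a diagram with value `0` at `l`; the braid relation then carries the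
    -- induction hypothesis across. For a bond `4`, a further box labelled `l` comes off and the
    -- value at `i` is `0` again; the alternative `cartan i l = -2` is not a possible value.
    rcases T.coxeterMatrix_mem hil with hm | hm | hm
    · rw [cartan_of_two hm] at h
      obtain ⟨j, hj, h5⟩ := ih N.card (by omega) h1 (i := i) (by omega) rfl
      refine ⟨j, hj, ?_⟩
      rw [h4, ← mul_assoc, simple_commute cs hm, mul_assoc, h5, mul_assoc]
    · rw [cartan_of_three hm] at h
      obtain ⟨N', h1', h2', h3', h4'⟩ := exists_removed cs h1 (i := i) (by omega)
      rw [h2', weight_add_single, cartan_of_three (hs ▸ hm)] at hl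
      obtain ⟨j, hj, h5⟩ := ih N'.card (by omega) h1' (i := l) (by omega) rfl
      refine ⟨j, hj, ?_⟩
      have hb := simple_braid_three cs hm
      calc cs.simple i * element cs M
          = (cs.simple i * (cs.simple l * cs.simple i)) * element cs N' := by
            rw [h4, h4']; group
        _ = cs.simple l * (cs.simple i * (cs.simple l * element cs N')) := by rw [hb]; group
        _ = element cs M * cs.simple j := by rw [h5, h4, h4']; group
    · have h6 := cartan_of_four hm
      obtain ⟨N', h1', h2', h3', h4'⟩ := exists_removed cs h1 (i := i) (by
        rcases weight_trichotomy h1 i with h7 | h7 | h7 <;> omega)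
      rw [h2', weight_add_single] at hl h
      rw [cartan_self] at h
      rcases h6 with h6 | h6
      · obtain ⟨N'', h1'', h2'', h3'', h4''⟩ := exists_removed cs h1' (i := l) (by omega)
        rw [h2'', weight_add_single] at h
        obtain ⟨j, hj, h5⟩ := ih N''.card (by omega) h1'' (i := i) (by omega) rfl
        refine ⟨j, hj, ?_⟩
        have hb := simple_braid_four cs hm
        calc cs.simple i * element cs M
            = (cs.simple i * (cs.simple l * (cs.simple i * cs.simple l))) * element cs N'' := by
              rw [h4, h4', h4'']; group
          _ = cs.simple l * (cs.simple i * (cs.simple l * (cs.simple i * element cs N''))) := by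
              rw [hb]; group
          _ = element cs M * cs.simple j := by rw [h5, h4, h4', h4'']; group
      · rcases weight_trichotomy h1 i with h7 | h7 | h7 <;>
          (rw [h2', weight_add_single, cartan_self] at h7; omega)

end Group
end HermitianType

theorem relativeR_self {B W : Type*} [Group W] {C : CoxeterMatrix B} (cs : CoxeterSystem C W)
    (J : Set B) (x : ℤ[X]) (u : W) : relativeR cs J x u u = 1 := by
  rw [relativeR, if_pos rfl]

theorem relativeR_eq_zero_of_length_lt {B W : Type*} [Group W] {C : CoxeterMatrix B}
    (cs : CoxeterSystem C W) (J : Set B) (x : ℤ[X]) {u v : W} (h : cs.length v < cs.length u) :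
    relativeR cs J x u v = 0 := by
  rw [relativeR, if_neg (by rintro rfl; exact lt_irrefl _ h),
    dif_neg fun h' => h.not_ge (BruhatLE.length_le cs h'.1)]

/-! ### Connected label sets and skew diagrams in a line -/

namespace HermitianType

variable {T : HermitianType}

/-- The full subgraph of the Coxeter graph with vertices `K` is connected. -/
def ConnectedOn (T : HermitianType) (K : Finset (Fin T.rank)) : Prop :=
  ∀ S ⊆ K, S.Nonempty → S ≠ K → ∃ i ∈ S, ∃ j ∈ K, j ∉ S ∧ T.cartan i j ≠ 0

theorem weight_add_sum (a : Fin T.rank → ℤ) (K : Finset (Fin T.rank)) (i : Fin T.rank) :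
    T.weight (a + ∑ j ∈ K, Pi.single j 1) i = T.weight a i - ∑ j ∈ K, T.cartan i j := by
  induction K using Finset.induction_on with
  | empty => simp
  | insert j K hj ih =>
    rw [Finset.sum_insert hj, Finset.sum_insert hj, add_comm (Pi.single j 1), ← add_assoc,
      weight_add_single, ih]
    ring

theorem sum_cartan_nonpos {K : Finset (Fin T.rank)} {i : Fin T.rank} (h : i ∉ K) :
    ∑ j ∈ K, T.cartan i j ≤ 0 :=
  Finset.sum_nonpos fun _ hj => cartan_nonpos fun hij => h (hij ▸ hj)

/-- A vanishing sum of nonpositive terms leaves `i` without neighbours in `K`. -/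
theorem ConnectedOn.eq_singleton {K : Finset (Fin T.rank)} (hK : T.ConnectedOn K) {i : Fin T.rank}
    (hi : i ∈ K) (h : ∑ j ∈ K.erase i, T.cartan i j = 0) : K = {i} := by
  by_contra hne
  obtain ⟨a, ha, j, hj, hja, hc⟩ := hK {i} (by simpa using hi) (by simp) (Ne.symm hne)
  obtain rfl := Finset.mem_singleton.1 ha
  rw [Finset.sum_eq_zero_iff_of_nonpos fun j hj => cartan_nonpos (Finset.ne_of_mem_erase hj).symm]
    at h
  exact hc (h j (Finset.mem_erase.2 ⟨by simpa using hja, hj⟩))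

/-- Removing a leaf keeps the graph connected. -/
theorem ConnectedOn.erase {K : Finset (Fin T.rank)} (hK : T.ConnectedOn K) {i : Fin T.rank}
    (hi : i ∈ K) (h : ∑ j ∈ K.erase i, T.cartan i j = -1) : T.ConnectedOn (K.erase i) := by
  obtain ⟨k, hk, hk0⟩ := Finset.exists_ne_zero_of_sum_ne_zero (by rw [h]; simp)
  have huniq : ∀ j ∈ K.erase i, T.cartan i j ≠ 0 → j = k := by
    intro j hj hj0
    by_contra hjk
    have h1 := cartan_nonpos (Finset.ne_of_mem_erase hk).symm
    have h2 := cartan_nonpos (Finset.ne_of_mem_erase hj).symm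
    have h3 := sum_cartan_nonpos (T := T) (K := ((K.erase i).erase k).erase j) (i := i) (by simp)
    rw [← Finset.add_sum_erase _ _ hk, ← Finset.add_sum_erase _ _ (Finset.mem_erase.2 ⟨hjk, hj⟩)]
      at h
    omega
  intro S hS hne hSK
  have hiS : i ∉ S := fun h => Finset.notMem_erase _ _ (hS h)
  have hSK' : S ⊆ K := hS.trans (Finset.erase_subset _ _)
  -- The only neighbour of `i` in `K` is `k`. If `k ∈ S`, an edge leaving `insert i S` cannot start
  -- at `i`; if `k ∉ S`, an edge leaving `S` cannot end at `i`. Either way it is an edge inside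
  -- `K.erase i`.
  by_cases hkS : k ∈ S
  · obtain ⟨a, ha, b, hb, hba, hc⟩ := hK (insert i S) (Finset.insert_subset hi hSK') (by simp)
      (fun h => hSK (by rw [← h, Finset.erase_insert hiS]))
    rw [Finset.mem_insert, not_or] at hba
    have hb' := Finset.mem_erase.2 ⟨hba.1, hb⟩
    rcases Finset.mem_insert.1 ha with rfl | ha
    · exact absurd (huniq b hb' hc ▸ hkS) hba.2
    · exact ⟨a, ha, b, hb', hba.2, hc⟩
  · obtain ⟨a, ha, b, hb, hba, hc⟩ := hK S hSK' hne (fun h => hiS (h ▸ hi))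
    refine ⟨a, ha, b, Finset.mem_erase.2 ⟨?_, hb⟩, hba, hc⟩
    rintro rfl
    exact hkS (huniq a (hS ha) (fun h => hc (cartan_eq_zero_comm.1 h)) ▸ ha)

/-- The hypothesis `hP` makes `P` an interval. If no edge leaves `S`, membership in `S` passes
between consecutive places, hence to all of `K`. -/
theorem connectedOn_of_path {K : Finset (Fin T.rank)} {P : ℕ → Prop} {f : ℕ → Fin T.rank}
    (hK : ∀ i, i ∈ K ↔ ∃ n, P n ∧ f n = i) (hP : ∀ m n, m < n → P m → P n → P (n - 1))
    (hf : ∀ n, P n → P (n + 1) → T.cartan (f n) (f (n + 1)) ≠ 0) : T.ConnectedOn K := by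
  intro S hS ⟨a, ha⟩ hSK
  by_contra! hcon
  have key : ∀ d m, P m → P (m + d) → (f m ∈ S ↔ f (m + d) ∈ S) := by
    intro d
    induction d with
    | zero => intro m _ _; rfl
    | succ d ih =>
      intro m hm hmd
      have hmd' := hP m (m + (d + 1)) (by omega) hm hmd
      have hc := hf _ hmd' (by convert hmd using 1; omega)
      rw [ih m hm hmd']
      have e1 := (hK _).2 ⟨_, hmd', rfl⟩
      have e2 := (hK _).2 ⟨_, hmd, rfl⟩
      constructor
      · intro h
        by_contra h'
        exact hc (hcon _ h _ e2 h')
      · intro h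
        by_contra h'
        exact hc (cartan_eq_zero_comm.1 (hcon _ h _ e1 h'))
  apply hSK
  refine hS.antisymm fun b hb => ?_
  obtain ⟨m, hm, rfl⟩ := (hK a).1 (hS ha)
  obtain ⟨n, hn, rfl⟩ := (hK b).1 hb
  rcases le_total m n with h | h <;> obtain ⟨d, rfl⟩ := Nat.exists_eq_add_of_le h
  · exact (key d m hm hn).1 ha
  · exact (key d n hn hm).2 ha

theorem count_eq_sum {M : Finset (ℕ × ℕ)} (hM : T.IsSubdiagram M) :
    T.count M = ∑ b ∈ M, Pi.single (T.index (T.label b.1 b.2)) 1 := by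
  ext i
  simp only [count, Finset.sum_apply, Pi.single_apply, Finset.sum_boole]
  refine congrArg _ (congrArg Finset.card (Finset.filter_congr ?_))
  rintro ⟨r, c⟩ hb
  obtain ⟨j, hj⟩ := exists_label_eq (hM.label_ne_zero hb)
  dsimp only
  rw [index_eq hj, hj, Fin.ext_iff]
  omega

/-- The box labelled `i` contributes to the neighbour count of the box labelled `j`, and no
contribution is negative. -/
theorem cartan_ne_zero_of_succ_column {r c : ℕ} {i j : Fin T.rank} (hi : T.label r c = i + 1)
    (hj : T.label r (c + 1) = j + 1) : T.cartan i j ≠ 0 := by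
  have hij : i ≠ j := by
    rintro rfl
    exact label_ne_of_succ_column hi hj
  obtain ⟨-, -, h⟩ := cartan_eq_neg_neighbours hj hij
  rw [if_pos ⟨by omega, hi⟩] at h
  split_ifs at h <;> omega

theorem cartan_ne_zero_of_succ_row {r c : ℕ} {i j : Fin T.rank} (hi : T.label r c = i + 1)
    (hj : T.label (r + 1) c = j + 1) : T.cartan i j ≠ 0 := by
  have hij : i ≠ j := by
    rintro rfl
    exact label_ne_of_succ_row hi hj
  obtain ⟨-, -, h⟩ := cartan_eq_neg_neighbours hj hij
  rw [if_pos (c := 0 < r + 1 ∧ T.label (r + 1 - 1) c = i + 1) ⟨by omega, hi⟩] at h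
  split_ifs at h <;> omega

/-- The labels in a skew diagram contained in a line are distinct and form a connected subgraph. -/
theorem exists_connectedOn {M L : Finset (ℕ × ℕ)} (hM : T.IsSubdiagram M) (hL : T.IsSubdiagram L)
    (hML : M ⊆ L) (h : InSingleRow (L \ M) ∨ InSingleColumn (L \ M)) :
    ∃ K, K.card = (L \ M).card ∧ T.ConnectedOn K ∧
      T.count L = T.count M + ∑ j ∈ K, Pi.single j 1 := by
  have hlab : ∀ r c, (r, c) ∈ L \ M → ∃ i : Fin T.rank, T.label r c = i + 1 := fun r c hb =>
    exists_label_eq (hL.label_ne_zero (Finset.mem_sdiff.1 hb).1)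
  have hinj : Set.InjOn (fun b : ℕ × ℕ => T.index (T.label b.1 b.2)) ↑(L \ M) := by
    rintro ⟨r, c⟩ hb ⟨r', c'⟩ hb' heq
    rw [Finset.mem_coe] at hb hb'
    obtain ⟨i, hi⟩ := hlab _ _ hb
    obtain ⟨j, hj⟩ := hlab _ _ hb'
    dsimp only at heq
    rw [index_eq hi, index_eq hj] at heq
    subst heq
    rcases h with ⟨k, h⟩ | ⟨k, h⟩ <;> obtain rfl := h _ hb <;> have h' := h _ hb' <;>
      dsimp only at h' <;> subst h'
    · rw [eq_of_label_eq_of_row (by omega) (hi.trans hj.symm)]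
    · rw [eq_of_label_eq_of_column (by omega) (hi.trans hj.symm)]
  refine ⟨(L \ M).image fun b => T.index (T.label b.1 b.2), Finset.card_image_of_injOn hinj, ?_, ?_⟩
  · rcases h with ⟨r, h⟩ | ⟨c, h⟩
    · refine connectedOn_of_path (P := fun c => (r, c) ∈ L \ M)
        (f := fun c => T.index (T.label r c)) (fun i => ?_) (fun m n hmn hm hn => ?_)
        (fun n hn hn' => ?_)
      · rw [Finset.mem_image]
        constructor
        · rintro ⟨⟨r', c⟩, hb, hi⟩
          obtain rfl := h _ hb
          exact ⟨c, hb, hi⟩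
        · rintro ⟨c, hb, hi⟩
          exact ⟨_, hb, hi⟩
      · rw [Finset.mem_sdiff] at hm hn ⊢
        have hm0 := hL.label_ne_zero hm.1
        have h1 := exists_predecessor hm0 (hL.label_ne_zero hn.1) le_rfl hmn.le (Or.inr hmn)
        exact ⟨hL.mem_of_le hn.1 (h1.resolve_right fun h => lt_irrefl _ h.1).2 le_rfl (by omega),
          fun h => hm.2 (hM.mem_of_le h hm0 le_rfl (by omega))⟩
      · obtain ⟨i, hi⟩ := hlab _ _ hn
        obtain ⟨j, hj⟩ := hlab _ _ hn'
        rw [index_eq hi, index_eq hj]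
        exact cartan_ne_zero_of_succ_column hi hj
    · refine connectedOn_of_path (P := fun r => (r, c) ∈ L \ M)
        (f := fun r => T.index (T.label r c)) (fun i => ?_) (fun m n hmn hm hn => ?_)
        (fun n hn hn' => ?_)
      · rw [Finset.mem_image]
        constructor
        · rintro ⟨⟨r, c'⟩, hb, hi⟩
          obtain rfl := h _ hb
          exact ⟨r, hb, hi⟩
        · rintro ⟨r, hb, hi⟩
          exact ⟨_, hb, hi⟩
      · rw [Finset.mem_sdiff] at hm hn ⊢
        have hm0 := hL.label_ne_zero hm.1
        have h1 := exists_predecessor hm0 (hL.label_ne_zero hn.1) hmn.le le_rfl (Or.inl hmn)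
        exact ⟨hL.mem_of_le hn.1 (h1.resolve_left fun h => lt_irrefl _ h.1).2 (by omega) le_rfl,
          fun h => hm.2 (hM.mem_of_le h hm0 (by omega) le_rfl)⟩
      · obtain ⟨i, hi⟩ := hlab _ _ hn
        obtain ⟨j, hj⟩ := hlab _ _ hn'
        rw [index_eq hi, index_eq hj]
        exact cartan_ne_zero_of_succ_row hi hj
  · rw [Finset.sum_image hinj, count_eq_sum hM, count_eq_sum hL, add_comm, Finset.sum_sdiff hML]

/-! ### The recursion along connected label sets -/

section Group

variable {W : Type*} [Group W] (cs : CoxeterSystem T.coxeterMatrix W)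

/-- A box of the skew diagram with `r + c` maximal is removable from `L`. Taking it off is left
multiplication by a simple reflection that lowers the length. -/
theorem bruhatLE_element {M L : Finset (ℕ × ℕ)} (hM : T.IsSubdiagram M) (hL : T.IsSubdiagram L)
    (hML : M ⊆ L) : BruhatLE cs (element cs M) (element cs L) := by
  induction hn : L.card generalizing L with
  | zero =>
    obtain rfl := Finset.card_eq_zero.1 hn
    obtain rfl := Finset.subset_empty.1 hML
    exact .refl
  | succ n ih =>
    rcases hML.eq_or_ssubset with rfl | hss
    · exact .refl
    obtain ⟨⟨r, c⟩, h1, h2⟩ := (L \ M).exists_max_image (fun b => b.1 + b.2)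
      (Finset.sdiff_nonempty.2 hss.not_subset)
    obtain ⟨h1, h1'⟩ := Finset.mem_sdiff.1 h1
    have h0 := hL.label_ne_zero h1
    have hr : T.IsRemovable L (r, c) := by
      refine (isRemovable_iff hL).2 ⟨h1, fun h => ?_, fun h => ?_⟩
      · have := h2 _ (Finset.mem_sdiff.2 ⟨h, fun h3 => h1' (hM.mem_of_le h3 h0 le_rfl (by omega))⟩)
        dsimp only at this
        omega
      · have := h2 _ (Finset.mem_sdiff.2 ⟨h, fun h3 => h1' (hM.mem_of_le h3 h0 (by omega) le_rfl)⟩)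
        dsimp only at this
        omega
    obtain ⟨i, hi⟩ := exists_label_eq h0
    have hc := Finset.card_erase_add_one h1
    refine (ih hr.2 (Finset.subset_erase.2 ⟨hML, h1'⟩) (by omega)).tail
      ⟨?_, cs.simple i, cs.isReflection_simple i, element_eq_simple_mul cs hL hr hi⟩
    rw [length_element cs hr.2, length_element cs hL]
    omega

/-- Writing the product as `w s_j` with `j ∈ J`, right multiplication by `s_j` returns the shorter
element `w`. -/
theorem simple_mul_element_notMem {M : Finset (ℕ × ℕ)} (hM : T.IsSubdiagram M) {i : Fin T.rank}
    (h : T.weight (T.count M) i = 0) :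
    cs.simple i * element cs M ∉ minCosetReps cs T.J := by
  intro hmem
  obtain ⟨j, hj, h1⟩ := exists_simple_mul_element_eq cs hM h
  have h2 := hmem j hj
  have h3 : ¬ cs.IsLeftDescent (element cs M) i := by
    rw [isLeftDescent_element_iff cs hM]; omega
  rw [cs.not_isLeftDescent_iff] at h3
  rw [h3, h1, cs.simple_mul_simple_cancel_right] at h2
  omega

/-- The line is replaced by a connected set `K` of labels because this hypothesis survives each step
of the recursion. -/
theorem relativeR_element_of_connectedOn {M L : Finset (ℕ × ℕ)} {K : Finset (Fin T.rank)}
    (hM : T.IsSubdiagram M) (hL : T.IsSubdiagram L)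
    (hc : T.count L = T.count M + ∑ j ∈ K, Pi.single j 1) (hne : K.Nonempty)
    (hK : T.ConnectedOn K) (hv : element cs L ∈ minCosetReps cs T.J) :
    relativeR cs T.J (-1) (element cs M) (element cs L) = (X - 1) * X ^ (K.card - 1) := by
  induction hn : L.card using Nat.strong_induction_on generalizing M L K with
  | _ n ih =>
    subst hn
    have hcard : (L.card : ℤ) = M.card + K.card := by
      rw [← sum_count hL, ← sum_count hM, hc]
      simp only [Pi.add_apply, Finset.sum_apply, Finset.sum_add_distrib]
      rw [Finset.sum_comm]
      simp
    have hKpos := hne.card_pos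
    have huv : element cs M ≠ element cs L := by
      intro h
      have := congrArg cs.length h
      rw [length_element cs hM, length_element cs hL] at this
      omega
    have hle : BruhatLE cs (element cs M) (element cs L) := by
      refine bruhatLE_element cs hM hL (subset_of_count_le hM hL ?_)
      rw [hc]
      refine le_add_of_nonneg_right (Finset.sum_nonneg fun j _ => ?_)
      exact Pi.single_nonneg.2 zero_le_one
    have hv1 : element cs L ≠ 1 := by
      intro h
      have := congrArg cs.length h
      rw [length_element cs hL, cs.length_one] at this
      omega
    rw [relativeR, if_neg huv, dif_pos ⟨hle, hv1⟩]
    have hi := (cs.exists_leftDescent_of_ne_one hv1).choose_spec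
    dsimp only
    -- The argument applies to any left descent of `v`, so the particular choice is forgotten.
    generalize (cs.exists_leftDescent_of_ne_one hv1).choose = i at hi ⊢
    have hsv := simple_mul_mem_minCosetReps cs hv hi
    have hwL := (isLeftDescent_element_iff cs hL).1 hi
    obtain ⟨L', hL', hcL, hcardL, heL⟩ := exists_removed cs hL hwL
    have hsL : cs.simple i * element cs L = element cs L' := by
      rw [heL, cs.simple_mul_simple_cancel_left]
    rw [hsL] at hsv ⊢
    have hwM : T.weight (T.count M) i = -1 + ∑ j ∈ K, T.cartan i j := by
      rw [hc, weight_add_sum] at hwL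
      omega
    split_ifs with h1 h2
    · obtain ⟨M', hM', hcM, hcardM, heM⟩ :=
        exists_removed cs hM ((isLeftDescent_element_iff cs hM).1 h1)
      rw [heM, cs.simple_mul_simple_cancel_left]
      refine ih L'.card (by omega) hM' hL' ?_ hne hK hsv rfl
      rw [hcL, hcM, add_right_comm] at hc
      exact add_right_cancel hc
    all_goals
      rw [isLeftDescent_element_iff cs hM] at h1
      -- Outside `K` the sum is nonpositive, so the value for `M` would be at most `-1` and `i`
      -- would be a descent of `u`.
      have hiK : i ∈ K := by
        by_contra hiK
        have := sum_cartan_nonpos hiK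
        rcases weight_trichotomy hM i with h | h | h <;> omega
      rw [← Finset.add_sum_erase _ _ hiK, cartan_self] at hwM
      have hcL' : T.count L' = T.count M + ∑ j ∈ K.erase i, Pi.single j 1 := by
        rw [hcL, ← Finset.sum_erase_add _ _ hiK, ← add_assoc] at hc
        exact add_right_cancel hc
    · have hw : T.weight (T.count M) i = 1 := by
        rcases weight_trichotomy hM i with h | h | h
        · exact h.1
        · exact absurd h.1 h1
        · exact absurd h2 (simple_mul_element_notMem cs hM h)
      obtain rfl := hK.eq_singleton hiK (by omega)
      simp only [Finset.erase_singleton, Finset.sum_empty, add_zero] at hcL'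
      obtain rfl : L' = M := (subset_of_count_le hL' hM hcL'.le).antisymm
        (subset_of_count_le hM hL' hcL'.ge)
      -- Now `s_i v = u`, so the first term is `q - 1`; the second vanishes because `s_i u` is
      -- longer than `s_i v`.
      rw [relativeR_self, relativeR_eq_zero_of_length_lt]
      · simp
      · rw [← isLeftDescent_element_iff cs hM, cs.not_isLeftDescent_iff] at h1
        omega
    · have hw : T.weight (T.count M) i = 0 := by
        rcases weight_trichotomy hM i with h | h | h
        -- The value `1` would again give `K = {i}`, hence `s_i u = v`, which lies in `W^J` contrary
        -- to the case assumption.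
        · exfalso
          obtain rfl := hK.eq_singleton hiK (by omega)
          obtain ⟨N, hN, hcN, -, heN⟩ := exists_added cs hM h.1
          rw [Finset.sum_singleton, ← hcN] at hc
          obtain rfl : L = N := (subset_of_count_le hL hN hc.le).antisymm
            (subset_of_count_le hN hL hc.ge)
          exact h2 (heN ▸ hv)
        · exact absurd h.1 h1
        · exact h
      -- Thus `i` is a leaf of `K`; its removal gives the factor `q` and keeps `K.erase i`
      -- connected.
      have hsum : ∑ j ∈ K.erase i, T.cartan i j = -1 := by omega
      have hne' : (K.erase i).Nonempty := by
        rw [Finset.nonempty_iff_ne_empty]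
        intro h
        rw [h] at hsum
        simp at hsum
      rw [ih L'.card (by omega) hM hL' hcL' hne' (hK.erase hiK hsum) hsv rfl,
        Finset.card_erase_of_mem hiK]
      have := hne'.card_pos
      rw [Finset.card_erase_of_mem hiK] at this
      obtain ⟨k, hk⟩ := Nat.exists_eq_add_of_le' this
      rw [hk, Nat.add_sub_cancel, pow_succ]
      ring

end Group
end HermitianType

theorem mainTheorem9 (T : HermitianType) {W : Type*} [Group W]
    (cs : CoxeterSystem T.coxeterMatrix W)
    (u v : W) (hu : u ∈ minCosetReps cs T.J) (hv : v ∈ minCosetReps cs T.J)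
    (M L : Finset (ℕ × ℕ)) (hM : T.IsDiagramOf cs M u) (hL : T.IsDiagramOf cs L v)
    (hML : M ⊆ L) (k : ℕ) (hk : 0 < k) (hcard : (L \ M).card = k)
    (hline : InSingleRow (L \ M) ∨ InSingleColumn (L \ M)) :
    relativeR cs T.J (-1) u v = (X - 1) * X ^ (k - 1) := by
  obtain ⟨hM, rfl⟩ := hM
  obtain ⟨hL, rfl⟩ := hL
  obtain ⟨K, hK, hconn, hc⟩ := HermitianType.exists_connectedOn hM hL hML hline
  rw [← hcard, ← hK]
  exact HermitianType.relativeR_element_of_connectedOn cs hM hL hc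
    (Finset.card_pos.1 (by omega)) hconn hv
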